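/- Let $W$ be a standard Wiener process relative to a filtration $(\mathcal F_t)_{t\ge 0}$. Let $a,c\in C([0,\infty))$ with $c(0)\neq 0$, let $\sigma\in C^1([0,\infty))$ be positive, let $A,B\in\mathbb R$, and let $m>0$ be rational. Powers $x^m$ of a real number $x$ are the usual real powers if $m$ has odd denominator (even in $x$ if the numerator is even, odd in $x$ if it is odd), and the signed powers $|x|^{m-1}x$ if the denominator is even; $x^{1/m}$ denotes $\operatorname{sgn}(x)|x|^{1/m}$. Let $(R_t,p_t)_{t\ge0}$ be an adapted solution with continuous paths of $$dR_t=c(t)\,p_t^{\,m}\,dt,\qquad dp_t=a(t)\,p_t\,dt+\sigma(t)\,dW_t,\qquad R_0=A,\quad R'_0=B,$$ where, if the numerator of $m$ is even, $p_0\ge 0$ is assumed; so $p_0=c_1:=(B/c(0))^{1/m}$. **Pathwise formula.** Put $q(s)=\sigma'(s)/\sigma(s)-a(s)$. Almost surely, for all $t\ge 0$, $$R_t=A+\int_0^t\Big[e^{-\int_0^u q(s)\,ds}\Big(\tfrac12\int_0^u e^{\int_0^s q(v)\,dv}\big(1-q(s)(2W_s-s)\big)\,ds+\frac{c_1}{\sigma(0)}\Big)+W_u-\frac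 u2\Big]^m\sigma(u)^m\,c(u)\,du .$$ For the rest let $m\ge1$ be an integer, $a\equiv0$ and $\sigma(t)\equiv\sigma>0$ constant. **Case $B=0$.** For every $t\ge0$, $R_t$ is square integrable. Put $L(m;c)=\frac{m!}{2^{m/2}(m/2)!}\int_0^t c(u)u^{m/2}\,du$ if $m$ is even and $L(m;c)=0$ if $m$ is odd. Then $E[R_t]=A+\sigma^mL(m;c)$ if $m$ is even, $E[R_t]=A$ if $m$ is odd, and $$\operatorname{Var}[R_t]=\sigma^{2m}\Big[\int_0^t\!\int_0^t c(s)c(u)\,\mathcal E_m(s,u)\,ds\,du-L(m;c)^2\Big],$$ where, with $\rho=\min(s,u)/\sqrt{su}$, $$\mathcal E_m(s,u)=(su)^{m/2}\,\frac{(m!)^2}{2^m}\sum_{j=0}^{m/2}\frac{(2\rho)^{2j}}{(2j)!\,[(\frac m2-j)!]^2}\quad(m\text{ even}),$$ $$\mathcal E_m(s,u)=(su)^{m/2}\,\frac{(m!)^2}{2^m}\sum_{j=0}^{(m-1)/2}\frac{(2\rho)^{2j+1}}{(2j+1)!\,[(\frac{m-1}2-j)!]^2}\quad(m\text{ odd}).$$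 **Case $B\ne0$.** For every $t\ge0$, $R_t$ is square integrable and $$E[R_t]=A+\sigma^m\sum_{j=0}^{\lfloor m/2\rfloor}\binom m{m-2j}\Big(\frac{c_1}\sigma\Big)^{m-2j}\frac{(2j)!}{2^jj!}\int_0^tc(u)u^j\,du .$$ Moreover, let $$T_t=A+\int_0^tc(u)\big[c_1^m+m\,c_1^{m-1}\sigma W_u\big]du$$ be the process obtained from $R_t=A+\int_0^tc(u)(c_1+\sigma W_u)^m\,du$ by first-order Taylor expansion of the integrand, and let $V_t=m^2\sigma^2c_1^{2m-2}\int_0^t\!\int_0^tc(u)c(s)\min(u,s)\,du\,ds$. Then $T_t$ is square integrable, $$E[T_t^2]=A^2+2A\,c_1^m\int_0^tc(u)\,du+c_1^{2m}\Big(\int_0^tc(u)\,du\Big)^2+V_t,\qquad \operatorname{Var}[T_t]=V_t,$$ and $\operatorname{Var}[R_t]\approx V_t$ in the following sense: for all $\sigma_0,T>0$ there is a constant $K$ depending only on $m,B,c,\sigma_0,T$ such that for all $A\in\mathbb R$, $0<\sigma\le\sigma_0$ and $0\le t\le T$, $$E[(R_t-T_t)^2]\le K\sigma^4,\qquad |\operatorname{Var}[R_t]-V_t|\le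 K\sigma^4 .$$ -/

import Mathlib

open MeasureTheory ProbabilityTheory Filter Set
open scoped NNReal ENNReal Nat Topology

universe v

noncomputable section

namespace InterestRate

/-- The power `x ^ q` of a real number with rational exponent. If `q` has odd denominator this is the
usual real power (an even function of `x` if the numerator is even, an odd one if it is odd);
if the denominator is even it is the signed power `|x| ^ (q - 1) * x`. -/
def ratPow (x : ℝ) (q : ℚ) : ℝ :=
  if Even q.num then |x| ^ (q : ℝ) else Real.sign x * |x| ^ (q : ℝ)

/-- The root `x ^ (1 / m)`: the signed root, which is the usual `m`-th root for `0 ≤ x`, and the only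
solution `y` of `ratPow y m = x` if the numerator of `m > 0` is odd. -/
def ratRoot (x : ℝ) (m : ℚ) : ℝ :=
  Real.sign x * |x| ^ ((1 : ℝ) / (m : ℝ))

section Paths

variable {Ω : Type*} {mΩ : MeasurableSpace Ω}

/-- `W` is a standard Wiener process relative to the filtration `𝓕`. -/
structure IsWiener (𝓕 : Filtration ℝ≥0 mΩ) (W : ℝ≥0 → Ω → ℝ) (P : Measure Ω) : Prop where
  brownian : IsBrownianReal W P
  adapted : StronglyAdapted 𝓕 W
  indep : ∀ s t : ℝ≥0, s ≤ t →
    Indep (MeasurableSpace.comap (fun ω => W t ω - W s ω) inferInstance) (𝓕 s) P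

/-- `I` is the Itô integral `∫₀ᵗ H dW` of the adapted integrand `H` with continuous paths:
the limit in probability of the left-endpoint Riemann sums. -/
structure IsItoIntegral (𝓕 : Filtration ℝ≥0 mΩ) (W : ℝ≥0 → Ω → ℝ) (P : Measure Ω)
    (H : ℝ≥0 → Ω → ℝ) (t : ℝ≥0) (I : Ω → ℝ) : Prop where
  adapted : StronglyAdapted 𝓕 H
  cont : ∀ᵐ ω ∂P, Continuous (fun s => H s ω)
  tendsto : TendstoInMeasure P
    (fun (N : ℕ) (ω : Ω) => ∑ i ∈ Finset.range N,
      H ((i : ℝ≥0) * t / N) ω * (W (((i : ℝ≥0) + 1) * t / N) ω - W ((i : ℝ≥0) * t / N) ω))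
    atTop I

/-- `(r, p)` solves, on `[0, ∞)`,
`dr = c(t) p ^ m dt`, `dp = (a(t) p ^ l + b(t) r ^ n) dt + σ(t) r ^ k dW`. -/
structure IsSolution (𝓕 : Filtration ℝ≥0 mΩ) (W : ℝ≥0 → Ω → ℝ) (P : Measure Ω)
    (m n k l : ℚ) (a b c σ : ℝ → ℝ) (r p : ℝ≥0 → Ω → ℝ) : Prop where
  adapted_r : StronglyAdapted 𝓕 r
  adapted_p : StronglyAdapted 𝓕 p
  cont_r : ∀ᵐ ω ∂P, Continuous (fun t => r t ω)
  cont_p : ∀ᵐ ω ∂P, Continuous (fun t => p t ω)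
  integrable_r : ∀ᵐ ω ∂P, ∀ t : ℝ≥0,
    IntervalIntegrable (fun s : ℝ => c s * ratPow (p s.toNNReal ω) m) volume 0 t
  integrable_p : ∀ᵐ ω ∂P, ∀ t : ℝ≥0,
    IntervalIntegrable (fun s : ℝ => a s * ratPow (p s.toNNReal ω) l
      + b s * ratPow (r s.toNNReal ω) n) volume 0 t
  eq_r : ∀ᵐ ω ∂P, ∀ t : ℝ≥0,
    r t ω = r 0 ω + ∫ s in (0 : ℝ)..t, c s * ratPow (p s.toNNReal ω) m
  eq_p : ∀ t : ℝ≥0, IsItoIntegral 𝓕 W P (fun s ω => σ s * ratPow (r s ω) k) t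
    (fun ω => p t ω - p 0 ω - ∫ s in (0 : ℝ)..t,
      (a s * ratPow (p s.toNNReal ω) l + b s * ratPow (r s.toNNReal ω) n))

/-- `(R, p)` solves the system above with `R₀ = A` and `R'₀ = B`. As `R'₀ = c(0) p₀ ^ m`, the datum
`B` fixes `p₀` only up to its sign if the numerator of `m` is even; then the nonnegative root is
taken, so that `p₀ = (B / c(0)) ^ (1 / m)` in all cases. -/
structure IsCauchySolution (𝓕 : Filtration ℝ≥0 mΩ) (W : ℝ≥0 → Ω → ℝ) (P : Measure Ω)
    (m n k l : ℚ) (a b c σ : ℝ → ℝ) (A B : ℝ) (R p : ℝ≥0 → Ω → ℝ) : Prop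
    extends IsSolution 𝓕 W P m n k l a b c σ R p where
  init : ∀ᵐ ω ∂P, R 0 ω = A
  init_deriv : ∀ᵐ ω ∂P, HasDerivWithinAt (fun t : ℝ => R t.toNNReal ω) B (Ici 0) 0
  root : Even m.num → ∀ᵐ ω ∂P, 0 ≤ p 0 ω

end Paths

/-- `σ'(s) / σ(s) - a(s)`. -/
def rate (a σ : ℝ → ℝ) (s : ℝ) : ℝ :=
  derivWithin σ (Ici 0) s / σ s - a s

/-- The explicit formula, at time `t`, along the path `w` of the Wiener process. -/
def explicitSolution (m : ℚ) (a c σ : ℝ → ℝ) (A B : ℝ) (w : ℝ≥0 → ℝ) (t : ℝ) : ℝ :=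
  A + ∫ u in (0 : ℝ)..t,
    ratPow
      (Real.exp (-∫ s in (0 : ℝ)..u, rate a σ s) *
          (1 / 2 * (∫ s in (0 : ℝ)..u, Real.exp (∫ v in (0 : ℝ)..s, rate a σ v) *
              (1 + (-(derivWithin σ (Ici 0) s / σ s) + a s) * (2 * w s.toNNReal - s)))
            + ratRoot (B / c 0) m * (σ 0)⁻¹)
        + w u.toNNReal - u / 2) m
      * ratPow (σ u) m * c u

/-- `L(m; c)` at time `t`; it vanishes for odd `m`. -/
def meanShift (m : ℕ) (c : ℝ → ℝ) (t : ℝ) : ℝ :=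
  if Even m then
    (m ! : ℝ) / (2 ^ (m / 2) * ((m / 2)! : ℝ)) * ∫ u in (0 : ℝ)..t, c u * u ^ (m / 2)
  else 0

/-- The mixed-moment kernel `𝓔ₘ(s, u)`. -/
def mixedKernel (m : ℕ) (s u : ℝ) : ℝ :=
  if Even m then
    Real.sqrt (s * u) ^ m * ((m ! : ℝ) ^ 2 / 2 ^ m) *
      ∑ j ∈ Finset.range (m / 2 + 1),
        (2 * (min s u / Real.sqrt (s * u))) ^ (2 * j)
          / (((2 * j)! : ℝ) * ((m / 2 - j)! : ℝ) ^ 2)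
  else
    Real.sqrt (s * u) ^ m * ((m ! : ℝ) ^ 2 / 2 ^ m) *
      ∑ j ∈ Finset.range ((m - 1) / 2 + 1),
        (2 * (min s u / Real.sqrt (s * u))) ^ (2 * j + 1)
          / (((2 * j + 1)! : ℝ) * (((m - 1) / 2 - j)! : ℝ) ^ 2)

/-- The process obtained from `A + ∫₀ᵗ c(u) (c₁ + σ W_u) ^ m du` by replacing the power with its
first-order Taylor polynomial at `c₁`. -/
def taylorProcess {Ω : Type*} (m : ℕ) (c : ℝ → ℝ) (A c₁ σ : ℝ) (W : ℝ≥0 → Ω → ℝ)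
    (t : ℝ) (ω : Ω) : ℝ :=
  A + ∫ u in (0 : ℝ)..t, c u * (c₁ ^ m + m * c₁ ^ (m - 1) * (σ * W u.toNNReal ω))

end InterestRate

end

open InterestRate

/-! Pathwise formula. As `σ` is deterministic and `C¹`, summation by parts turns the Riemann sums of
`∫ σ dW` into sums that converge along every continuous path with `W₀ = 0`, with limit `σ(t) W_t -
∫₀ᵗ σ' W ds` (`tendsto_riemannSum`). Limits in measure being almost surely unique, the momentum
equation becomes a linear integral equation along each path, first for each fixed `t` and then, by
density and continuity, for all `t` at once (`IsSolution.momentum_eq`). The function `p - σW` is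
then `C¹`, and uniqueness for a linear ODE gives the closed form (`linear_solution`). The one-sided
derivative of `R` at `0` fixes `p₀` through `B = c(0) p₀ ^ m`. The drift-like terms of the formula
cancel: with `Q' = q` and `Q(0) = 0`, `½ ∫₀ᵘ e^Q (1 + q s) ds = e^{Q(u)} u / 2`.

Moments. For `a = 0` and constant `σ`, `p_t = c₁ + σ W_t`, so `R_t = A + ∑ₖ (m choose k) c₁^(m-k)
σ^k Z_k` with `Z_k = ∫₀ᵗ c W^k`. Fubini reduces first and second moments of the `Z_k` to `E[W_s^j
W_u^k]`. Such a mixed moment is `j! k!` times a Taylor coefficient of `exp(s x²/2 + r x y + u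
y²/2)`, `r = min(s, u)`: Gaussian integration by parts gives the moments the recurrence that the
differential equation of the generating function gives its coefficients
(`integral_pow_mul_add_pow_eq`). The coefficient with `j = k = m` is the kernel `𝓔ₘ` up to
normalisation. If `B = 0`, then `c₁ = 0` and only `Z_m` survives.

Taylor approximation. `T_t` consists of the terms `k = 0, 1`, so `R_t - T_t` is a sum over `k ≥ 2`
and its mean square is `O(σ⁴)`. The covariance of `T_t` with this remainder would be of order `σ³`,
but its leading part is a multiple of `E[Z₁ Z₂]`, an integral of odd Gaussian moments, hence zero.
The constant `A` enters neither `R_t - T_t` nor the variances, so the bounds are uniform in `A`. -/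

/-! ### Moments of Gaussian laws -/

/-- The coefficient of `x ^ n` in `exp (s x² / 2)`, for an integer `n`. -/
noncomputable def gaussCoeff (s : ℝ) (n : ℤ) : ℝ :=
  if 0 ≤ n ∧ Even n then (s / 2) ^ (n.toNat / 2) / ((n.toNat / 2)! : ℝ) else 0

lemma gaussCoeff_of_neg (s : ℝ) {n : ℤ} (hn : n < 0) : gaussCoeff s n = 0 := by
  simp [gaussCoeff, hn]

lemma gaussCoeff_zero (s : ℝ) : gaussCoeff s 0 = 1 := by simp [gaussCoeff]

lemma gaussCoeff_even (s : ℝ) (k : ℕ) :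
    gaussCoeff s ((2 * k : ℕ) : ℤ) = (s / 2) ^ k / (k ! : ℝ) := by
  have h : Even ((2 * k : ℕ) : ℤ) := by simp
  rw [gaussCoeff, if_pos ⟨by positivity, h⟩, Int.toNat_natCast, Nat.mul_div_cancel_left _ two_pos]

lemma gaussCoeff_odd (s : ℝ) {n : ℤ} (hn : Odd n) : gaussCoeff s n = 0 := by
  rw [gaussCoeff, if_neg]
  rintro ⟨-, h⟩
  exact (Int.not_even_iff_odd.2 hn) h

/-- Coefficient form of `x G' = s x² G` for `G = exp(s x²/2)`. With integer indices and zero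
coefficients at negative ones, no boundary case has to be excluded. -/
lemma gaussCoeff_recurrence (s : ℝ) (n : ℤ) :
    (n : ℝ) * gaussCoeff s n = s * gaussCoeff s (n - 2) := by
  rcases lt_or_ge n 0 with h | h
  · rw [gaussCoeff_of_neg s h, gaussCoeff_of_neg s (by omega)]; simp
  rcases Int.even_or_odd n with he | ho
  · obtain ⟨k, rfl⟩ := Int.eq_ofNat_of_zero_le h
    obtain ⟨j, rfl⟩ : ∃ j, k = 2 * j := by
      have : Even k := by exact_mod_cast he
      exact this.two_dvd
    rcases j with _ | j
    · simp [gaussCoeff_of_neg]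
    · have : ((2 * (j + 1) : ℕ) : ℤ) - 2 = ((2 * j : ℕ) : ℤ) := by push_cast; ring
      rw [this, gaussCoeff_even, gaussCoeff_even, Nat.factorial_succ]
      have : (j ! : ℝ) ≠ 0 := by positivity
      push_cast
      field_simp
      ring
  · rw [gaussCoeff_odd s ho, gaussCoeff_odd s (by grind)]; simp

lemma integrable_pow_gaussianReal (v : ℝ≥0) (n : ℕ) :
    Integrable (fun x : ℝ => x ^ n) (gaussianReal 0 v) := by
  have := (memLp_id_gaussianReal (μ := 0) (v := v) n).integrable_norm_pow'
  refine this.mono' (by fun_prop) (ae_of_all _ fun x => by simp)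

/-- The moment generating function satisfies `M' = v t M`, and differentiating this `n + 1` times
gives the identity. The parameter `t` is kept so that the induction step is a differentiation; only
`t = 0` is used afterwards. -/
lemma integral_pow_mul_exp_gaussianReal (v : ℝ≥0) (n : ℕ) (t : ℝ) :
    ∫ x, x ^ (n + 2) * Real.exp (t * x) ∂(gaussianReal 0 v)
      = v * t * ∫ x, x ^ (n + 1) * Real.exp (t * x) ∂(gaussianReal 0 v)
        + v * (n + 1) * ∫ x, x ^ n * Real.exp (t * x) ∂(gaussianReal 0 v) := by
  have hd : ∀ (n : ℕ) (t : ℝ), HasDerivAt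
      (fun t => ∫ x, x ^ n * Real.exp (t * x) ∂(gaussianReal 0 v))
      (∫ x, x ^ (n + 1) * Real.exp (t * x) ∂(gaussianReal 0 v)) t := fun n t =>
    hasDerivAt_integral_pow_mul_exp_real (X := id) (μ := gaussianReal 0 v)
      (by simp [integrableExpSet_id_gaussianReal]) n
  have h1 : ∀ t : ℝ, ∫ x, x ^ 1 * Real.exp (t * x) ∂(gaussianReal 0 v)
      = v * t * ∫ x, x ^ 0 * Real.exp (t * x) ∂(gaussianReal 0 v) := by
    intro t
    have e : (fun t : ℝ => ∫ x, x ^ 0 * Real.exp (t * x) ∂(gaussianReal 0 v))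
        = fun t => Real.exp (v * t ^ 2 / 2) := by
      have := mgf_id_gaussianReal (μ := 0) (v := v)
      simp only [zero_mul, zero_add] at this
      rw [← this]
      ext t
      simp [mgf]
    have a := hd 0 t
    rw [e] at a
    have b : HasDerivAt (fun t : ℝ => Real.exp (v * t ^ 2 / 2))
        (Real.exp (v * t ^ 2 / 2) * (v * t)) t := by
      have := (((hasDerivAt_pow 2 t).const_mul (v : ℝ)).div_const 2).exp
      convert this using 2
      push_cast; ring
    have := a.unique b
    rw [zero_add] at this
    rw [this, congrFun e t]; ring
  induction n generalizing t with
  | zero =>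
    have a := hd 1 t
    have b := ((hasDerivAt_id t).const_mul (v : ℝ)).mul (hd 0 t)
    have c := a.unique (b.congr_of_eventuallyEq (Eventually.of_forall fun t => h1 t))
    simp only [zero_add, Nat.cast_zero] at c ⊢
    rw [show (1 + 1) = 2 from rfl] at c
    rw [c]; simp; ring
  | succ n ih =>
    have a := hd (n + 2) t
    have b := (((hasDerivAt_id t).const_mul (v : ℝ)).mul (hd (n + 1) t)).add
      ((hd n t).const_mul ((v : ℝ) * (n + 1)))
    have c := a.unique (b.congr_of_eventuallyEq (Eventually.of_forall fun t => ih t))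
    rw [show n + 1 + 2 = n + 2 + 1 from rfl, c]
    simp; ring

lemma integral_pow_add_two_gaussianReal (v : ℝ≥0) (n : ℕ) :
    ∫ x, x ^ (n + 2) ∂(gaussianReal 0 v) = v * (n + 1) * ∫ x, x ^ n ∂(gaussianReal 0 v) := by
  simpa using integral_pow_mul_exp_gaussianReal v n 0

lemma integral_pow_gaussianReal (v : ℝ≥0) (n : ℕ) :
    ∫ x, x ^ n ∂(gaussianReal 0 v) = (n ! : ℝ) * gaussCoeff v n := by
  induction n using Nat.twoStepInduction with
  | zero => simp [gaussCoeff_zero]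
  | one =>
    rw [gaussCoeff_odd _ (by decide)]
    simp [integral_id_gaussianReal]
  | more n ih _ =>
    rw [integral_pow_add_two_gaussianReal, ih, Nat.factorial_succ, Nat.factorial_succ]
    have := gaussCoeff_recurrence v ((n + 2 : ℕ) : ℤ)
    rw [show ((n + 2 : ℕ) : ℤ) - 2 = n by push_cast; ring] at this
    push_cast at this ⊢
    linear_combination (-(n + 1) * (n ! : ℝ)) * this

lemma integral_pow_succ_gaussianReal (v : ℝ≥0) (n : ℕ) :
    ∫ x, x ^ (n + 1) ∂(gaussianReal 0 v) = v * n * ∫ x, x ^ (n - 1) ∂(gaussianReal 0 v) := by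
  rcases n with _ | n
  · simp [integral_id_gaussianReal]
  · rw [integral_pow_add_two_gaussianReal]; simp

/-- The coefficient of `x ^ a * y ^ b` in `exp (s x² / 2 + r x y + u y² / 2)`; the sum does not
depend on `N` once `a ≤ N`. -/
noncomputable def gaussCoeff₂ (N : ℕ) (s r u : ℝ) (a b : ℤ) : ℝ :=
  ∑ j ∈ Finset.range (N + 1), gaussCoeff s (a - j) * gaussCoeff u (b - j) * (r ^ j / (j ! : ℝ))

lemma gaussCoeff₂_of_neg (N : ℕ) (s r u : ℝ) {a b : ℤ} (h : a < 0 ∨ b < 0) :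
    gaussCoeff₂ N s r u a b = 0 := by
  refine Finset.sum_eq_zero fun j _ => ?_
  rcases h with h | h
  · rw [gaussCoeff_of_neg s (by omega)]; simp
  · rw [gaussCoeff_of_neg u (by omega)]; simp

lemma gaussCoeff₂_succ {N : ℕ} (s r u : ℝ) {a b : ℤ} (h : a ≤ N) :
    gaussCoeff₂ (N + 1) s r u a b = gaussCoeff₂ N s r u a b := by
  rw [gaussCoeff₂, Finset.sum_range_succ, gaussCoeff_of_neg s (n := a - (N + 1 : ℕ)) (by
    push_cast; omega)]
  simp [gaussCoeff₂]

lemma gaussCoeff₂_of_le {N M : ℕ} (hNM : N ≤ M) (s r u : ℝ) {a b : ℤ} (h : a ≤ N) :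
    gaussCoeff₂ M s r u a b = gaussCoeff₂ N s r u a b := by
  induction M, hNM using Nat.le_induction with
  | base => rfl
  | succ M hM ih => rw [gaussCoeff₂_succ _ _ _ (by omega), ih]

lemma gaussCoeff₂_zero_left (N : ℕ) (s r u : ℝ) (b : ℤ) :
    gaussCoeff₂ N s r u 0 b = gaussCoeff u b := by
  rw [gaussCoeff₂_of_le (Nat.zero_le N) _ _ _ (by simp)]
  simp [gaussCoeff₂, gaussCoeff_zero]

/-- Coefficient form of `x ∂ₓG = (s x² + r x y) G`. Writing `a = (a - j) + j`, the first part uses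
the recurrence in one variable; the second shifts `j`, which shortens the sum by one term. -/
lemma gaussCoeff₂_recurrence (N : ℕ) (s r u : ℝ) (a b : ℤ) :
    (a : ℝ) * gaussCoeff₂ (N + 1) s r u a b
      = s * gaussCoeff₂ (N + 1) s r u (a - 2) b + r * gaussCoeff₂ N s r u (a - 1) (b - 1) := by
  have h1 : (a : ℝ) * gaussCoeff₂ (N + 1) s r u a b
      = ∑ j ∈ Finset.range (N + 1 + 1), ((((a - j : ℤ) : ℝ) * gaussCoeff s (a - j)) *
          gaussCoeff u (b - j) * (r ^ j / (j ! : ℝ)))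
        + ∑ j ∈ Finset.range (N + 1 + 1), (j : ℝ) * (gaussCoeff s (a - j) *
          gaussCoeff u (b - j) * (r ^ j / (j ! : ℝ))) := by
    rw [gaussCoeff₂, Finset.mul_sum, ← Finset.sum_add_distrib]
    refine Finset.sum_congr rfl fun j _ => ?_
    push_cast; ring
  rw [h1, Finset.sum_range_succ' (fun j : ℕ => (j : ℝ) * _)]
  simp only [gaussCoeff_recurrence]
  congr 1
  · rw [gaussCoeff₂, Finset.mul_sum]
    refine Finset.sum_congr rfl fun j _ => ?_
    rw [show a - (j : ℤ) - 2 = a - 2 - j by ring]; ring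
  · rw [gaussCoeff₂, Finset.mul_sum]
    simp only [Nat.cast_zero, zero_mul, add_zero]
    refine Finset.sum_congr rfl fun j _ => ?_
    rw [Nat.factorial_succ, show a - ((j + 1 : ℕ) : ℤ) = a - 1 - j by push_cast; ring,
      show b - ((j + 1 : ℕ) : ℤ) = b - 1 - j by push_cast; ring]
    have : (j ! : ℝ) ≠ 0 := by positivity
    push_cast
    field_simp
    ring

/-! ### Mixed moments of `X` and `X + Y` for independent centred Gaussian `X`, `Y` -/

section MixedMoments

variable {Ω : Type*} {mΩ : MeasurableSpace Ω} {P : Measure Ω} {X Y : Ω → ℝ} {s v : ℝ≥0}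

lemma integrable_pow_of_hasLaw (hX : HasLaw X (gaussianReal 0 s) P) (n : ℕ) :
    Integrable (fun ω => X ω ^ n) P := by
  have := integrable_pow_gaussianReal s n
  rw [← hX.map_eq] at this
  exact this.comp_aemeasurable hX.aemeasurable

lemma integral_pow_of_hasLaw (hX : HasLaw X (gaussianReal 0 s) P) (n : ℕ) :
    ∫ ω, X ω ^ n ∂P = ∫ x, x ^ n ∂(gaussianReal 0 s) := by
  rw [← hX.map_eq, integral_map hX.aemeasurable (by fun_prop)]

lemma integral_pow_mul_add_pow (hX : HasLaw X (gaussianReal 0 s) P)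
    (hY : HasLaw Y (gaussianReal 0 v) P) (hXY : IndepFun X Y P) (a b : ℕ) :
    Integrable (fun ω => X ω ^ a * (X ω + Y ω) ^ b) P ∧
    ∫ ω, X ω ^ a * (X ω + Y ω) ^ b ∂P = ∑ k ∈ Finset.range (b + 1),
      (b.choose k : ℝ) * ((∫ x, x ^ (a + k) ∂(gaussianReal 0 s)) *
        ∫ x, x ^ (b - k) ∂(gaussianReal 0 v)) := by
  have hi : ∀ k l : ℕ, IndepFun (fun ω => X ω ^ k) (fun ω => Y ω ^ l) P := fun k l =>
    hXY.comp (measurable_id.pow_const k) (measurable_id.pow_const l)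
  have hint : ∀ k l : ℕ, Integrable (fun ω => X ω ^ k * Y ω ^ l) P := fun k l =>
    (hi k l).integrable_mul (integrable_pow_of_hasLaw hX k) (integrable_pow_of_hasLaw hY l)
  have e : (fun ω => X ω ^ a * (X ω + Y ω) ^ b) = fun ω => ∑ k ∈ Finset.range (b + 1),
      (b.choose k : ℝ) * (X ω ^ (a + k) * Y ω ^ (b - k)) := by
    ext ω
    rw [add_pow, Finset.mul_sum]
    refine Finset.sum_congr rfl fun k _ => ?_
    ring
  rw [e]
  refine ⟨integrable_finsetSum _ fun k _ => (hint _ _).const_mul _, ?_⟩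
  rw [integral_finsetSum _ fun k _ => (hint _ _).const_mul _]
  refine Finset.sum_congr rfl fun k _ => ?_
  rw [integral_const_mul, ← integral_pow_of_hasLaw hX, ← integral_pow_of_hasLaw hY]
  congr 1
  exact (hi _ _).integral_fun_mul_eq_mul_integral
    (integrable_pow_of_hasLaw hX _).aestronglyMeasurable
    (integrable_pow_of_hasLaw hY _).aestronglyMeasurable

/-- Gaussian integration by parts `E[X f(X)] = s E[f'(X)]` with `f(x) = x^a (x + Y)^b`, carried out
on the binomial expansion. The truncated exponents `a - 1` and `b - 1` are harmless: their factors
`a` and `b` vanish exactly when truncation occurs. -/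
lemma integral_pow_succ_mul_add_pow (hX : HasLaw X (gaussianReal 0 s) P)
    (hY : HasLaw Y (gaussianReal 0 v) P) (hXY : IndepFun X Y P) (a b : ℕ) :
    ∫ ω, X ω ^ (a + 1) * (X ω + Y ω) ^ b ∂P
      = s * a * ∫ ω, X ω ^ (a - 1) * (X ω + Y ω) ^ b ∂P
        + s * b * ∫ ω, X ω ^ a * (X ω + Y ω) ^ (b - 1) ∂P := by
  simp only [(integral_pow_mul_add_pow hX hY hXY _ _).2]
  have h1 : ∀ k, ∫ x, x ^ (a + 1 + k) ∂(gaussianReal 0 s)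
      = s * a * ∫ x, x ^ (a - 1 + k) ∂(gaussianReal 0 s)
        + s * k * ∫ x, x ^ (a + (k - 1)) ∂(gaussianReal 0 s) := by
    intro k
    rw [show a + 1 + k = a + k + 1 by ring, integral_pow_succ_gaussianReal]
    rcases a with _ | a
    · rcases k with _ | k <;> simp
    · rcases k with _ | k
      · simp
      · rw [show a + 1 - 1 + (k + 1) = a + 1 + (k + 1) - 1 by omega,
          show a + 1 + (k + 1 - 1) = a + 1 + (k + 1) - 1 by omega]
        push_cast; ring
  simp only [h1]
  rw [Finset.mul_sum, Finset.mul_sum]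
  have h2 : ∑ k ∈ Finset.range (b + 1), (b.choose k : ℝ) *
      ((s * k * ∫ x, x ^ (a + (k - 1)) ∂(gaussianReal 0 s)) *
        ∫ x, x ^ (b - k) ∂(gaussianReal 0 v))
      = ∑ k ∈ Finset.range (b - 1 + 1), s * b * (((b - 1).choose k : ℝ) *
        ((∫ x, x ^ (a + k) ∂(gaussianReal 0 s)) *
          ∫ x, x ^ (b - 1 - k) ∂(gaussianReal 0 v))) := by
    rcases b with _ | b
    · simp
    · rw [Finset.sum_range_succ']
      simp only [Nat.cast_zero, mul_zero, zero_mul, add_zero, Nat.add_sub_cancel,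
        Nat.add_sub_add_right]
      refine Finset.sum_congr rfl fun k _ => ?_
      have : ((b + 1).choose (k + 1) : ℝ) * (k + 1) = (b + 1) * b.choose k := by
        exact_mod_cast (Nat.add_one_mul_choose_eq b k).symm
      push_cast
      linear_combination (s * (∫ x, x ^ (a + k) ∂(gaussianReal 0 s)) *
          ∫ x, x ^ (b - k) ∂(gaussianReal 0 v)) * this
  rw [← h2, ← Finset.sum_add_distrib]
  refine Finset.sum_congr rfl fun k _ => ?_
  ring

lemma integral_pow_mul_add_pow_eq (hX : HasLaw X (gaussianReal 0 s) P)
    (hY : HasLaw Y (gaussianReal 0 v) P) (hXY : IndepFun X Y P) (a b : ℕ) :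
    ∫ ω, X ω ^ a * (X ω + Y ω) ^ b ∂P
      = (a ! : ℝ) * (b ! : ℝ) * gaussCoeff₂ a s s (s + v : ℝ≥0) a b := by
  have hb0 : ∀ b, ∫ ω, X ω ^ 0 * (X ω + Y ω) ^ b ∂P
      = (0 ! : ℝ) * (b ! : ℝ) * gaussCoeff₂ 0 s s (s + v : ℝ≥0) (0 : ℕ) b := by
    intro b
    have hl : HasLaw (X + Y) (gaussianReal 0 (s + v)) P := 
      ⟨hX.aemeasurable.add hY.aemeasurable, by
        simpa using gaussianReal_add_gaussianReal_of_indepFun hXY hX.map_eq hY.map_eq⟩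
    have := integral_pow_of_hasLaw hl b
    simp only [Pi.add_apply] at this
    simp only [pow_zero, one_mul, this, integral_pow_gaussianReal]
    simp [gaussCoeff₂_zero_left]
  induction a using Nat.strong_induction_on generalizing b with
  | _ a ih =>
    rcases a with _ | a
    · exact hb0 b
    · rw [integral_pow_succ_mul_add_pow hX hY hXY, ih (a - 1) (by omega), ih a (by omega)]
      have hr := gaussCoeff₂_recurrence a s s (s + v : ℝ≥0) ((a + 1 : ℕ) : ℤ) b
      rw [show ((a + 1 : ℕ) : ℤ) - 1 = a by push_cast; ring] at hr
      have e1 : (a : ℝ) * ((a - 1)! : ℝ) * gaussCoeff₂ (a - 1) s s (s + v : ℝ≥0) (a - 1 : ℕ) b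
          = (a ! : ℝ) * gaussCoeff₂ (a + 1) s s (s + v : ℝ≥0) (((a + 1 : ℕ) : ℤ) - 2) b := by
        rcases a with _ | a
        · simp [gaussCoeff₂_of_neg]
        · rw [show ((a + 1 + 1 : ℕ) : ℤ) - 2 = a by push_cast; ring,
            gaussCoeff₂_of_le (N := a) (M := a + 1 + 1) (by omega) _ _ _ le_rfl,
            Nat.factorial_succ]
          simp
      have e2 : (b : ℝ) * ((b - 1)! : ℝ) * gaussCoeff₂ a s s (s + v : ℝ≥0) a (b - 1 : ℕ)
          = (b ! : ℝ) * gaussCoeff₂ a s s (s + v : ℝ≥0) a ((b : ℤ) - 1) := by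
        rcases b with _ | b
        · simp [gaussCoeff₂_of_neg]
        · rw [Nat.factorial_succ]; simp
      rw [Nat.factorial_succ a]
      push_cast at hr e1 e2 ⊢
      linear_combination (s : ℝ) * (b ! : ℝ) * e1 + (s : ℝ) * (a ! : ℝ) * e2
        - (a ! : ℝ) * (b ! : ℝ) * hr

end MixedMoments

/-! ### The kernel `𝓔ₘ` as a coefficient of the bivariate Gaussian generating function -/

lemma sum_range_even {f : ℕ → ℝ} (hf : ∀ j, f (2 * j + 1) = 0) (k : ℕ) :
    ∑ j ∈ Finset.range (2 * k + 1), f j = ∑ i ∈ Finset.range (k + 1), f (2 * i) := by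
  induction k with
  | zero => simp
  | succ k ih =>
    rw [Finset.sum_range_succ _ (k + 1), ← ih, show 2 * (k + 1) + 1 = 2 * k + 1 + 1 + 1 by ring,
      Finset.sum_range_succ, Finset.sum_range_succ, hf, add_zero]
    rfl

lemma sum_range_odd {f : ℕ → ℝ} (hf : ∀ j, f (2 * j) = 0) (k : ℕ) :
    ∑ j ∈ Finset.range (2 * k + 2), f j = ∑ i ∈ Finset.range (k + 1), f (2 * i + 1) := by
  induction k with
  | zero => simpa [Finset.sum_range_succ] using hf 0
  | succ k ih =>
    rw [Finset.sum_range_succ _ (k + 1), ← ih, show 2 * (k + 1) + 2 = 2 * k + 2 + 1 + 1 by ring,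
      Finset.sum_range_succ, Finset.sum_range_succ, show 2 * k + 2 = 2 * (k + 1) by ring, hf,
      add_zero]
    rfl

lemma mixedKernel_eq_gaussCoeff₂ {m : ℕ} {s u : ℝ} (hs : 0 < s) (hu : 0 < u) :
    mixedKernel m s u = (m ! : ℝ) * (m ! : ℝ) * gaussCoeff₂ m s (min s u) u m m := by
  have hsu : 0 < s * u := mul_pos hs hu
  set q := Real.sqrt (s * u) with hq
  have hqp : 0 < q := Real.sqrt_pos.2 hsu
  have hq2 : q ^ 2 = s * u := Real.sq_sqrt hsu.le
  set r := min s u with hr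
  -- With `m = 2i + j`, the factor `q^m (r/q)^j` equals `(s u)^i r^j`, so the square root and the
  -- correlation disappear.
  have term : ∀ i j : ℕ, q ^ (2 * i + j) * ((m ! : ℝ) ^ 2 / 2 ^ (2 * i + j)) *
      ((2 * (r / q)) ^ j / ((j ! : ℝ) * (i ! : ℝ) ^ 2))
      = (m ! : ℝ) * (m ! : ℝ) * ((s / 2) ^ i / (i ! : ℝ) * ((u / 2) ^ i / (i ! : ℝ))
          * (r ^ j / (j ! : ℝ))) := by
    intro i j
    have h1 : (i ! : ℝ) ≠ 0 := by positivity
    have h2 : (j ! : ℝ) ≠ 0 := by positivity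
    have h3 : q ≠ 0 := hqp.ne'
    rw [pow_add q, pow_mul q, hq2, pow_add, pow_mul (2 : ℝ), mul_pow, div_pow, div_pow, mul_pow, div_pow,
      show (2 : ℝ) ^ 2 = 2 * 2 by norm_num, mul_pow (2 : ℝ) 2]
    field_simp
  rcases Nat.even_or_odd m with he | ho
  · obtain ⟨k, rfl⟩ := he.two_dvd
    rw [mixedKernel, if_pos he, gaussCoeff₂, Finset.mul_sum, sum_range_even, Finset.mul_sum,
      Nat.mul_div_cancel_left _ two_pos]
    · refine Finset.sum_congr rfl fun j hj => ?_
      obtain ⟨i, rfl⟩ : ∃ i, k = j + i := Nat.exists_eq_add_of_le (by simp at hj; omega)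
      rw [show ((2 * (j + i) : ℕ) : ℤ) - ((2 * j : ℕ) : ℤ) = ((2 * i : ℕ) : ℤ) by push_cast; ring,
        gaussCoeff_even, gaussCoeff_even, Nat.add_sub_cancel_left, ← term,
        show 2 * (j + i) = 2 * i + 2 * j by ring]
    · intro j
      rw [gaussCoeff_odd s (by push_cast; exact ⟨k - j - 1, by ring⟩)]
      simp
  · obtain ⟨k, rfl⟩ := ho
    rw [mixedKernel, if_neg (by simp), gaussCoeff₂, Finset.mul_sum, sum_range_odd, Finset.mul_sum,
      Nat.add_sub_cancel, Nat.mul_div_cancel_left _ two_pos]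
    · refine Finset.sum_congr rfl fun j hj => ?_
      obtain ⟨i, rfl⟩ : ∃ i, k = j + i := Nat.exists_eq_add_of_le (by simp at hj; omega)
      rw [show ((2 * (j + i) + 1 : ℕ) : ℤ) - ((2 * j + 1 : ℕ) : ℤ) = ((2 * i : ℕ) : ℤ) by
        push_cast; ring, gaussCoeff_even, gaussCoeff_even, Nat.add_sub_cancel_left, ← term,
        show 2 * (j + i) + 1 = 2 * i + (2 * j + 1) by ring]
    · intro j
      rw [gaussCoeff_odd s (by push_cast; exact ⟨k - j, by ring⟩)]
      simp

lemma mixedKernel_comm (m : ℕ) (s u : ℝ) : mixedKernel m s u = mixedKernel m u s := by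
  simp only [mixedKernel, mul_comm s u, min_comm s u]

lemma mixedKernel_zero_left {m : ℕ} (hm : 0 < m) (u : ℝ) : mixedKernel m 0 u = 0 := by
  simp [mixedKernel, hm.ne']

/-! ### Second moments of time integrals -/

section TimeIntegrals

variable {Ω : Type*} {mΩ : MeasurableSpace Ω} {P : Measure Ω}
  {Φ Ψ : ℝ → Ω → ℝ} {t C : ℝ}

lemma integrable_mul_of_sq {f g : Ω → ℝ} (hf : AEStronglyMeasurable f P)
    (hg : AEStronglyMeasurable g P) (hf2 : Integrable (fun ω => f ω ^ 2) P)
    (hg2 : Integrable (fun ω => g ω ^ 2) P) : Integrable (fun ω => f ω * g ω) P :=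
  ((memLp_two_iff_integrable_sq hf).2 hf2).integrable_mul
    ((memLp_two_iff_integrable_sq hg).2 hg2)

lemma integral_abs_mul_le {f g : Ω → ℝ} (hf : AEStronglyMeasurable f P)
    (hg : AEStronglyMeasurable g P) (hf2 : Integrable (fun ω => f ω ^ 2) P)
    (hg2 : Integrable (fun ω => g ω ^ 2) P) :
    ∫ ω, |f ω * g ω| ∂P ≤ (∫ ω, f ω ^ 2 ∂P + ∫ ω, g ω ^ 2 ∂P) / 2 := by
  rw [← integral_add hf2 hg2, ← integral_div]
  refine integral_mono (integrable_mul_of_sq hf hg hf2 hg2).abs ((hf2.add hg2).div_const 2)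
    fun ω => ?_
  rw [abs_mul, ← sq_abs (f ω), ← sq_abs (g ω)]
  nlinarith [sq_nonneg (|f ω| - |g ω|)]

variable [IsProbabilityMeasure P]

/-- Uniform second-moment bounds and `|xy| ≤ (x² + y²)/2` bound the inner integral by `C`, and `(0,
t]²` has finite measure. This is the hypothesis of Fubini used for all moments below. -/
lemma integrable_prod_mul (hΦ : Measurable (Function.uncurry Φ))
    (hΨ : Measurable (Function.uncurry Ψ))
    (hΦi : ∀ u ∈ Icc 0 t, Integrable (fun ω => Φ u ω ^ 2) P)
    (hΨi : ∀ u ∈ Icc 0 t, Integrable (fun ω => Ψ u ω ^ 2) P)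
    (hΦC : ∀ u ∈ Icc 0 t, ∫ ω, Φ u ω ^ 2 ∂P ≤ C) (hΨC : ∀ u ∈ Icc 0 t, ∫ ω, Ψ u ω ^ 2 ∂P ≤ C) :
    Integrable (fun z : (ℝ × ℝ) × Ω => Φ z.1.1 z.2 * Ψ z.1.2 z.2)
      (((volume.restrict (Ioc 0 t)).prod (volume.restrict (Ioc 0 t))).prod P) := by
  have hm : Measurable (fun z : (ℝ × ℝ) × Ω => Φ z.1.1 z.2 * Ψ z.1.2 z.2) :=
    (hΦ.comp (f := fun z : (ℝ × ℝ) × Ω => (z.1.1, z.2)) (by fun_prop)).mul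
      (hΨ.comp (f := fun z : (ℝ × ℝ) × Ω => (z.1.2, z.2)) (by fun_prop))
  have hΦm : ∀ u, AEStronglyMeasurable (Φ u) P := fun u =>
    (hΦ.comp (measurable_prodMk_left (x := u))).aestronglyMeasurable
  have hΨm : ∀ u, AEStronglyMeasurable (Ψ u) P := fun u =>
    (hΨ.comp (measurable_prodMk_left (x := u))).aestronglyMeasurable
  have hae : ∀ᵐ x ∂((volume.restrict (Ioc (0 : ℝ) t)).prod (volume.restrict (Ioc (0 : ℝ) t))),
      x.1 ∈ Icc 0 t ∧ x.2 ∈ Icc 0 t := by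
    rw [Measure.prod_restrict]
    filter_upwards [ae_restrict_mem (measurableSet_Ioc.prod measurableSet_Ioc)] with x hx
    exact ⟨Ioc_subset_Icc_self hx.1, Ioc_subset_Icc_self hx.2⟩
  rw [integrable_prod_iff hm.aestronglyMeasurable]
  refine ⟨?_, ?_⟩
  · filter_upwards [hae] with x hx
    exact integrable_mul_of_sq (hΦm _) (hΨm _) (hΦi _ hx.1) (hΨi _ hx.2)
  · refine Integrable.of_bound (C := C)
      (hm.stronglyMeasurable.norm.integral_prod_right').aestronglyMeasurable ?_
    filter_upwards [hae] with x hx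
    rw [Real.norm_of_nonneg (integral_nonneg fun _ => norm_nonneg _)]
    refine (integral_abs_mul_le (hΦm x.1) (hΨm x.2) (hΦi _ hx.1) (hΨi _ hx.2)).trans ?_
    linarith [hΦC _ hx.1, hΨC _ hx.2]

lemma integral_timeIntegral_mul (ht : 0 ≤ t) (hΦ : Measurable (Function.uncurry Φ))
    (hΨ : Measurable (Function.uncurry Ψ))
    (hΦi : ∀ u ∈ Icc 0 t, Integrable (fun ω => Φ u ω ^ 2) P)
    (hΨi : ∀ u ∈ Icc 0 t, Integrable (fun ω => Ψ u ω ^ 2) P)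
    (hΦC : ∀ u ∈ Icc 0 t, ∫ ω, Φ u ω ^ 2 ∂P ≤ C) (hΨC : ∀ u ∈ Icc 0 t, ∫ ω, Ψ u ω ^ 2 ∂P ≤ C) :
    Integrable (fun ω => (∫ s in (0 : ℝ)..t, Φ s ω) * ∫ u in (0 : ℝ)..t, Ψ u ω) P ∧
    ∫ ω, (∫ s in (0 : ℝ)..t, Φ s ω) * (∫ u in (0 : ℝ)..t, Ψ u ω) ∂P
      = ∫ s in (0 : ℝ)..t, ∫ u in (0 : ℝ)..t, ∫ ω, Φ s ω * Ψ u ω ∂P := by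
  have h := integrable_prod_mul hΦ hΨ hΦi hΨi hΦC hΨC
  simp only [intervalIntegral.integral_of_le ht]
  have e : ∀ ω, (∫ s in Ioc 0 t, Φ s ω) * (∫ u in Ioc 0 t, Ψ u ω)
      = ∫ z, Φ z.1 ω * Ψ z.2 ω ∂((volume.restrict (Ioc 0 t)).prod (volume.restrict (Ioc 0 t))) :=
    fun ω => (integral_prod_mul (fun s => Φ s ω) (fun u => Ψ u ω)).symm
  simp only [e]
  refine ⟨h.integral_prod_right, ?_⟩
  rw [← integral_prod_symm _ h, integral_prod _ h, integral_prod _ h.integral_prod_left]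

lemma measurable_timeIntegral (ht : 0 ≤ t) (hΦ : Measurable (Function.uncurry Φ)) :
    Measurable (fun ω => ∫ s in (0 : ℝ)..t, Φ s ω) := by
  simp only [intervalIntegral.integral_of_le ht]
  exact (hΦ.stronglyMeasurable.integral_prod_left').measurable

lemma memLp_timeIntegral (ht : 0 ≤ t) (hΦ : Measurable (Function.uncurry Φ))
    (hΦi : ∀ u ∈ Icc 0 t, Integrable (fun ω => Φ u ω ^ 2) P)
    (hΦC : ∀ u ∈ Icc 0 t, ∫ ω, Φ u ω ^ 2 ∂P ≤ C) :
    MemLp (fun ω => ∫ s in (0 : ℝ)..t, Φ s ω) 2 P := by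
  rw [memLp_two_iff_integrable_sq (measurable_timeIntegral ht hΦ).aestronglyMeasurable]
  simp only [sq]
  exact (integral_timeIntegral_mul ht hΦ hΦ hΦi hΦi hΦC hΦC).1

lemma integral_timeIntegral_sq_le (ht : 0 ≤ t) (hΦ : Measurable (Function.uncurry Φ))
    (hΦi : ∀ u ∈ Icc 0 t, Integrable (fun ω => Φ u ω ^ 2) P)
    (hΦC : ∀ u ∈ Icc 0 t, ∫ ω, Φ u ω ^ 2 ∂P ≤ C) :
    ∫ ω, (∫ s in (0 : ℝ)..t, Φ s ω) ^ 2 ∂P ≤ C * t ^ 2 := by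
  have hΦm : ∀ u, AEStronglyMeasurable (Φ u) P := fun u =>
    (hΦ.comp (measurable_prodMk_left (x := u))).aestronglyMeasurable
  simp only [sq (∫ s in (0 : ℝ)..t, Φ s _)]
  rw [(integral_timeIntegral_mul ht hΦ hΦ hΦi hΦi hΦC hΦC).2]
  have h1 : ∀ s ∈ uIoc 0 t, ∀ u ∈ uIoc 0 t, ‖∫ ω, Φ s ω * Φ u ω ∂P‖ ≤ C := by
    intro s hs u hu
    rw [uIoc_of_le ht] at hs hu
    have hs' := Ioc_subset_Icc_self hs
    have hu' := Ioc_subset_Icc_self hu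
    refine (norm_integral_le_integral_norm _).trans
      ((integral_abs_mul_le (hΦm s) (hΦm u) (hΦi _ hs') (hΦi _ hu')).trans ?_)
    linarith [hΦC _ hs', hΦC _ hu']
  have h2 : ∀ s ∈ uIoc 0 t, ‖∫ u in (0 : ℝ)..t, ∫ ω, Φ s ω * Φ u ω ∂P‖ ≤ C * |t - 0| :=
    fun s hs => intervalIntegral.norm_integral_le_of_norm_le_const (h1 s hs)
  refine (le_abs_self _).trans
    ((intervalIntegral.norm_integral_le_of_norm_le_const h2).trans (le_of_eq ?_))
  rw [sub_zero, abs_of_nonneg ht]; ring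

lemma integral_timeIntegral (ht : 0 ≤ t) (hΦ : Measurable (Function.uncurry Φ))
    (hΦi : ∀ u ∈ Icc 0 t, Integrable (fun ω => Φ u ω ^ 2) P)
    (hΦC : ∀ u ∈ Icc 0 t, ∫ ω, Φ u ω ^ 2 ∂P ≤ C) :
    ∫ ω, (∫ s in (0 : ℝ)..t, Φ s ω) ∂P = ∫ s in (0 : ℝ)..t, ∫ ω, Φ s ω ∂P := by
  rcases ht.eq_or_lt with rfl | ht'
  · simp
  have hΦC' : ∀ u ∈ Icc 0 t, ∫ ω, Φ u ω ^ 2 ∂P ≤ max C 1 := fun u hu =>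
    (hΦC u hu).trans (le_max_left _ _)
  -- The first moment is the product formula with `Ψ = 1`, whose time integral is `t`; the positive
  -- factor `t` is then cancelled.
  have h := (integral_timeIntegral_mul (Ψ := fun _ _ => (1 : ℝ)) (C := max C 1) ht hΦ
    measurable_const hΦi (by simp) hΦC' (by simp)).2
  simp only [intervalIntegral.integral_const, sub_zero, smul_eq_mul, mul_one, integral_mul_const,
    intervalIntegral.integral_const_mul] at h
  exact mul_right_cancel₀ ht'.ne' (by rw [h, mul_comm])

end TimeIntegrals

/-! ### Brownian motion with continuous paths -/

section Brownian

variable {Ω : Type*} {mΩ : MeasurableSpace Ω} {P : Measure Ω} {X : ℝ≥0 → Ω → ℝ}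

/-- Setting `W` to zero on a measurable null set makes every path continuous, which yields the joint
measurability in `(u, ω)` needed for Fubini. -/
lemma exists_continuous_version {W : ℝ≥0 → Ω → ℝ} (hW : IsBrownianReal W P)
    (hm : ∀ t, Measurable (W t)) :
    ∃ X : ℝ≥0 → Ω → ℝ, IsPreBrownianReal X P ∧ (∀ ω, Continuous fun t => X t ω) ∧
      (∀ t, Measurable (X t)) ∧ ∀ᵐ ω ∂P, ∀ t, X t ω = W t ω := by
  obtain ⟨N, hN, hNm, hN0⟩ := exists_measurable_superset_of_null (ae_iff.1 hW.cont)
  have hae : ∀ᵐ ω ∂P, ∀ t, (Nᶜ).indicator (W t) ω = W t ω := by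
    have : ∀ᵐ ω ∂P, ω ∉ N := measure_eq_zero_iff_ae_notMem.1 hN0
    filter_upwards [this] with ω hω t
    simp [hω]
  refine ⟨fun t => (Nᶜ).indicator (W t), ?_, fun ω => ?_, fun t => (hm t).indicator hNm.compl, hae⟩
  · refine hW.toIsPreBrownianReal.congr fun t => ?_
    filter_upwards [hae] with ω hω using (hω t).symm
  · by_cases h : ω ∈ N
    · simp [h, continuous_const]
    · simp only [indicator, mem_compl_iff, h, not_false_eq_true, if_true]
      by_contra hc
      exact h (hN hc)

lemma gaussCoeff₂_of_odd (N : ℕ) (s r u : ℝ) {a b : ℤ} (h : Odd (a + b)) :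
    gaussCoeff₂ N s r u a b = 0 := by
  refine Finset.sum_eq_zero fun j _ => ?_
  rcases Int.even_or_odd (a - j) with h1 | h1
  · rw [gaussCoeff_odd u (n := b - j) (by grind)]; simp
  · rw [gaussCoeff_odd s h1]; simp

lemma ProbabilityTheory.IsPreBrownianReal.mixed_moment (hX : IsPreBrownianReal X P) {s u : ℝ≥0} (hsu : s ≤ u)
    (a b : ℕ) :
    Integrable (fun ω => X s ω ^ a * X u ω ^ b) P ∧
    ∫ ω, X s ω ^ a * X u ω ^ b ∂P = (a ! : ℝ) * (b ! : ℝ) * gaussCoeff₂ a s s u a b := by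
  obtain ⟨v, rfl⟩ := exists_add_of_le hsu
  have h1 := hX.hasLaw_eval s
  have h2 : HasLaw (X (s + v) - X s) (gaussianReal 0 v) P := by
    have := hX.hasLaw_sub (s + v) s
    convert this using 2
    ext
    simp
  have h3 := hX.hasIndepIncrements.indepFun_eval_sub zero_le hsu hX.eval_zero_ae_eq_zero
  have h4 := (integral_pow_mul_add_pow h1 h2 h3 a b).1
  have h5 := integral_pow_mul_add_pow_eq h1 h2 h3 a b
  simp only [Pi.sub_apply, add_sub_cancel] at h4 h5
  exact ⟨h4, h5⟩

lemma ProbabilityTheory.IsPreBrownianReal.integrable_pow_mul_pow (hX : IsPreBrownianReal X P) (s u : ℝ≥0)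
    (a b : ℕ) : Integrable (fun ω => X s ω ^ a * X u ω ^ b) P := by
  rcases le_total s u with h | h
  · exact (mixed_moment hX h a b).1
  · simpa only [mul_comm] using (mixed_moment hX h b a).1

lemma ProbabilityTheory.IsPreBrownianReal.integral_pow_mul_pow_of_odd (hX : IsPreBrownianReal X P) (s u : ℝ≥0)
    {a b : ℕ} (hab : Odd (a + b)) : ∫ ω, X s ω ^ a * X u ω ^ b ∂P = 0 := by
  rcases le_total s u with h | h
  · rw [(mixed_moment hX h a b).2, gaussCoeff₂_of_odd _ _ _ _ (by exact_mod_cast hab), mul_zero]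
  · have := (mixed_moment hX h b a).2
    rw [gaussCoeff₂_of_odd _ _ _ _ (by rw [add_comm]; exact_mod_cast hab), mul_zero] at this
    simpa only [mul_comm] using this

lemma ProbabilityTheory.IsPreBrownianReal.integral_pow_mul_pow_self (hX : IsPreBrownianReal X P) {m : ℕ}
    (hm : 0 < m) (s u : ℝ≥0) : ∫ ω, X s ω ^ m * X u ω ^ m ∂P = mixedKernel m s u := by
  wlog h : s ≤ u generalizing s u with H
  · rw [mixedKernel_comm, ← H u s (le_of_not_ge h)]
    simp only [mul_comm]
  rcases eq_zero_or_pos s with rfl | hs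
  · rw [NNReal.coe_zero, mixedKernel_zero_left hm]
    refine integral_eq_zero_of_ae ?_
    filter_upwards [hX.eval_zero_ae_eq_zero] with ω hω
    simp [hω, hm.ne']
  · rw [(mixed_moment hX h m m).2, mixedKernel_eq_gaussCoeff₂ (by exact_mod_cast hs)
      (by exact_mod_cast hs.trans_le h), min_eq_left (by exact_mod_cast h)]

lemma ProbabilityTheory.IsPreBrownianReal.integral_mul_self (hX : IsPreBrownianReal X P) (s u : ℝ≥0) :
    ∫ ω, X s ω * X u ω ∂P = min (s : ℝ) u := by
  have := hX.covariance_eval s u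
  have hP := hX.isGaussianProcess.isProbabilityMeasure
  rw [covariance_eq_sub (hX.isGaussianProcess.hasGaussianLaw_eval _).memLp_two
    (hX.isGaussianProcess.hasGaussianLaw_eval _).memLp_two, hX.integral_eval, zero_mul,
    sub_zero] at this
  simpa using this

lemma ProbabilityTheory.IsPreBrownianReal.integral_pow (hX : IsPreBrownianReal X P) (u : ℝ≥0) (n : ℕ) :
    ∫ ω, X u ω ^ n ∂P = (n ! : ℝ) * gaussCoeff u n := by
  rw [integral_pow_of_hasLaw (hX.hasLaw_eval u), integral_pow_gaussianReal]

lemma gaussCoeff_nonneg {s : ℝ} (hs : 0 ≤ s) (n : ℤ) : 0 ≤ gaussCoeff s n := by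
  unfold gaussCoeff
  split_ifs <;> positivity

lemma gaussCoeff_mono {s u : ℝ} (hs : 0 ≤ s) (hsu : s ≤ u) (n : ℤ) :
    gaussCoeff s n ≤ gaussCoeff u n := by
  unfold gaussCoeff
  split_ifs
  · gcongr
  · exact le_rfl

end Brownian

/-! ### Moments of `∫₀ᵗ c(u) W_u ^ k du` -/

/-- `∫₀ᵗ c(u) X_u ^ k du`. -/
noncomputable def powerIntegral {Ω : Type*} (c : ℝ → ℝ) (X : ℝ≥0 → Ω → ℝ) (t : ℝ) (k : ℕ)
    (ω : Ω) : ℝ :=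
  ∫ u in (0 : ℝ)..t, c u * X u.toNNReal ω ^ k

/-- A bound of `E[(∫₀ᵗ c(u) W_u ^ k du)²]` for `t ≤ T`, if `|c| ≤ M`. -/
noncomputable def powerIntegralBound (M T : ℝ) (k : ℕ) : ℝ :=
  M ^ 2 * (((k + k)! : ℝ) * gaussCoeff T (k + k : ℕ)) * T ^ 2

section PowerIntegral

variable {Ω : Type*} {mΩ : MeasurableSpace Ω} {P : Measure Ω} {X : ℝ≥0 → Ω → ℝ} {c : ℝ → ℝ}
  {M T t : ℝ}

/-- Only the values of `c` on `[0, ∞)` are controlled. Freezing `c` at `c(0)` on negative times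
gives an integrand continuous on all of `ℝ` with the same integral. -/
lemma powerIntegral_eq (ht : 0 ≤ t) (k : ℕ) (ω : Ω) : powerIntegral c X t k ω
    = ∫ u in (0 : ℝ)..t, c (max u 0) * X u.toNNReal ω ^ k := by
  refine intervalIntegral.integral_congr fun u hu => ?_
  rw [uIcc_of_le ht] at hu
  simp [max_eq_left hu.1]

lemma continuous_comp_max (hc : ContinuousOn c (Ici 0)) : Continuous fun u => c (max u 0) :=
  hc.comp_continuous (by fun_prop) fun u => le_max_right u 0

lemma measurable_integrand (hc : ContinuousOn c (Ici 0)) (hX : ∀ ω, Continuous fun t => X t ω)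
    (hXm : ∀ t, Measurable (X t)) (k : ℕ) :
    Measurable (Function.uncurry fun (u : ℝ) ω => c (max u 0) * X u.toNNReal ω ^ k) := by
  refine measurable_uncurry_of_continuous_of_measurable (fun ω => ?_) fun u => ?_
  · exact (continuous_comp_max hc).mul (((hX ω).comp continuous_real_toNNReal).pow k)
  · exact ((hXm _).pow_const k).const_mul _

variable (hB : IsPreBrownianReal X P)
include hB

lemma integrable_integrand_sq (k : ℕ) (u : ℝ) :
    Integrable (fun ω => (c (max u 0) * X u.toNNReal ω ^ k) ^ 2) P := by
  simp only [mul_pow, sq (X _ _ ^ k)]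
  exact (IsPreBrownianReal.integrable_pow_mul_pow hB _ _ k k).const_mul _

lemma integral_integrand_sq_le (hM : ∀ u ∈ Icc 0 T, |c u| ≤ M) (k : ℕ) {u : ℝ}
    (hu : u ∈ Icc 0 T) : ∫ ω, (c (max u 0) * X u.toNNReal ω ^ k) ^ 2 ∂P
      ≤ M ^ 2 * (((k + k)! : ℝ) * gaussCoeff T (k + k : ℕ)) := by
  simp only [mul_pow, sq (X _ _ ^ k), ← pow_add]
  rw [integral_const_mul, IsPreBrownianReal.integral_pow hB, max_eq_left hu.1,
    Real.coe_toNNReal _ hu.1]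
  have h1 := hM u hu
  have h2 := gaussCoeff_mono hu.1 hu.2 (k + k : ℕ)
  have h3 := gaussCoeff_nonneg hu.1 (k + k : ℕ)
  have h4 : c u ^ 2 ≤ M ^ 2 := sq_le_sq' (abs_le.1 h1).1 (abs_le.1 h1).2
  gcongr

lemma memLp_powerIntegral (hc : ContinuousOn c (Ici 0)) (hX : ∀ ω, Continuous fun t => X t ω)
    (hXm : ∀ t, Measurable (X t)) (ht : 0 ≤ t) (k : ℕ) : MemLp (powerIntegral c X t k) 2 P := by
  have := hB.isGaussianProcess.isProbabilityMeasure
  obtain ⟨M, hM⟩ := isCompact_Icc.exists_bound_of_continuousOn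
    (hc.mono (Icc_subset_Ici_self : Icc 0 t ⊆ Ici 0))
  rw [funext (powerIntegral_eq ht k)]
  exact memLp_timeIntegral ht (measurable_integrand hc hX hXm k)
    (fun u _ => integrable_integrand_sq hB k u) fun u hu => integral_integrand_sq_le hB hM k hu

lemma integral_powerIntegral (hc : ContinuousOn c (Ici 0)) (hX : ∀ ω, Continuous fun t => X t ω)
    (hXm : ∀ t, Measurable (X t)) (ht : 0 ≤ t) (k : ℕ) :
    ∫ ω, powerIntegral c X t k ω ∂P = (k ! : ℝ) * ∫ u in (0 : ℝ)..t, c u * gaussCoeff u k := by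
  have := hB.isGaussianProcess.isProbabilityMeasure
  obtain ⟨M, hM⟩ := isCompact_Icc.exists_bound_of_continuousOn
    (hc.mono (Icc_subset_Ici_self : Icc 0 t ⊆ Ici 0))
  rw [funext (powerIntegral_eq ht k), integral_timeIntegral ht (measurable_integrand hc hX hXm k)
    (fun u _ => integrable_integrand_sq hB k u) fun u hu => integral_integrand_sq_le hB hM k hu,
    ← intervalIntegral.integral_const_mul]
  refine intervalIntegral.integral_congr fun u hu => ?_
  rw [uIcc_of_le ht] at hu
  rw [integral_const_mul, IsPreBrownianReal.integral_pow hB, max_eq_left hu.1,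
    Real.coe_toNNReal _ hu.1]
  ring

lemma integral_powerIntegral_mul (hc : ContinuousOn c (Ici 0))
    (hX : ∀ ω, Continuous fun t => X t ω) (hXm : ∀ t, Measurable (X t)) (ht : 0 ≤ t) (j k : ℕ)
    {E : ℝ → ℝ → ℝ}
    (hE : ∀ s u : ℝ≥0, ∫ ω, X s ω ^ j * X u ω ^ k ∂P = E s u) :
    ∫ ω, powerIntegral c X t j ω * powerIntegral c X t k ω ∂P
      = ∫ s in (0 : ℝ)..t, ∫ u in (0 : ℝ)..t, c s * c u * E s u := by
  have := hB.isGaussianProcess.isProbabilityMeasure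
  obtain ⟨M, hM⟩ := isCompact_Icc.exists_bound_of_continuousOn
    (hc.mono (Icc_subset_Ici_self : Icc 0 t ⊆ Ici 0))
  simp only [powerIntegral_eq ht]
  rw [(integral_timeIntegral_mul ht (measurable_integrand hc hX hXm j)
    (measurable_integrand hc hX hXm k)
    (fun u _ => integrable_integrand_sq hB j u) (fun u _ => integrable_integrand_sq hB k u)
    (fun u hu => (integral_integrand_sq_le hB hM j hu).trans (le_max_left _ _))
    (fun u hu => (integral_integrand_sq_le hB hM k hu).trans (le_max_right _ _))).2]
  refine intervalIntegral.integral_congr fun s hs => ?_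
  refine intervalIntegral.integral_congr fun u hu => ?_
  rw [uIcc_of_le ht] at hs hu
  rw [max_eq_left hs.1, max_eq_left hu.1]
  have h := hE s.toNNReal u.toNNReal
  rw [Real.coe_toNNReal _ hs.1, Real.coe_toNNReal _ hu.1] at h
  rw [← h, ← integral_const_mul]
  refine integral_congr_ae (ae_of_all _ fun ω => ?_)
  ring

lemma integral_powerIntegral_sq_le (hc : ContinuousOn c (Ici 0))
    (hX : ∀ ω, Continuous fun t => X t ω) (hXm : ∀ t, Measurable (X t)) (ht : 0 ≤ t)
    (htT : t ≤ T) (hM : ∀ u ∈ Icc 0 T, |c u| ≤ M) (k : ℕ) :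
    ∫ ω, powerIntegral c X t k ω ^ 2 ∂P ≤ powerIntegralBound M T k := by
  have := hB.isGaussianProcess.isProbabilityMeasure
  simp only [powerIntegral_eq ht]
  refine (integral_timeIntegral_sq_le ht (measurable_integrand hc hX hXm k)
    (fun u _ => integrable_integrand_sq hB k u)
    fun u hu => integral_integrand_sq_le hB hM k ⟨hu.1, hu.2.trans htT⟩).trans ?_
  have := gaussCoeff_nonneg (ht.trans htT) (k + k : ℕ)
  unfold powerIntegralBound
  gcongr

end PowerIntegral

/-! ### Rational powers -/

/-- This form exhibits the signed power as a difference of continuous functions, which settles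
continuity at `0`, where the sign jumps. -/
lemma sign_mul_rpow_eq {q : ℝ} (hq : 0 < q) (x : ℝ) :
    Real.sign x * |x| ^ q = (max x 0) ^ q - (max (-x) 0) ^ q := by
  rcases lt_trichotomy x 0 with h | rfl | h
  · rw [Real.sign_of_neg h, max_eq_right h.le, max_eq_left (by linarith), abs_of_neg h,
      Real.zero_rpow hq.ne']
    ring
  · simp
  · rw [Real.sign_of_pos h, max_eq_left h.le, max_eq_right (by linarith), abs_of_pos h,
      Real.zero_rpow hq.ne']
    ring

lemma continuous_ratPow {m : ℚ} (hm : 0 < m) : Continuous fun x => ratPow x m := by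
  have hq : (0 : ℝ) < (m : ℝ) := by exact_mod_cast hm
  unfold ratPow
  split_ifs
  · exact continuous_abs.rpow_const fun _ => Or.inr hq.le
  · simp only [sign_mul_rpow_eq hq]
    exact ((continuous_id.max continuous_const).rpow_const fun _ => Or.inr hq.le).sub
      ((continuous_neg.max continuous_const).rpow_const fun _ => Or.inr hq.le)

lemma ratPow_mul_of_pos (m : ℚ) {x : ℝ} (hx : 0 < x) (y : ℝ) :
    ratPow (x * y) m = ratPow y m * ratPow x m := by
  have hs : Real.sign (x * y) = Real.sign y := by
    rcases lt_trichotomy y 0 with h | rfl | h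
    · rw [Real.sign_of_neg h, Real.sign_of_neg (mul_neg_of_pos_of_neg hx h)]
    · simp
    · rw [Real.sign_of_pos h, Real.sign_of_pos (mul_pos hx h)]
  unfold ratPow
  rw [hs, abs_mul, Real.mul_rpow (abs_nonneg _) (abs_nonneg _), Real.sign_of_pos hx]
  split_ifs <;> ring

lemma ratPow_zero_right (x : ℝ) : ratPow x 0 = 1 := by simp [ratPow]

lemma sign_mul_abs_self (x : ℝ) : Real.sign x * |x| = x := by
  rcases lt_trichotomy x 0 with h | rfl | h
  · rw [Real.sign_of_neg h, abs_of_neg h]; ring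
  · simp
  · rw [Real.sign_of_pos h, abs_of_pos h]; ring

lemma ratPow_one_right (x : ℝ) : ratPow x 1 = x := by
  simp [ratPow, sign_mul_abs_self]

lemma ratPow_natCast (x : ℝ) (m : ℕ) : ratPow x m = x ^ m := by
  have hr : |x| ^ (((m : ℚ) : ℝ)) = |x| ^ m := by
    rw [Rat.cast_natCast, Real.rpow_natCast]
  rw [ratPow, hr]
  simp only [Rat.num_natCast, Int.even_coe_nat]
  split_ifs with h
  · exact h.pow_abs x
  · rw [Nat.not_even_iff_odd] at h
    rcases lt_trichotomy x 0 with h0 | rfl | h0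
    · rw [Real.sign_of_neg h0, abs_of_neg h0, h.neg_pow]; ring
    · simp [h.pos.ne']
    · rw [Real.sign_of_pos h0, abs_of_pos h0]; ring

lemma ratRoot_ratPow {m : ℚ} (hm : 0 < m) {x : ℝ} (hx : Even m.num → 0 ≤ x) :
    ratRoot (ratPow x m) m = x := by
  have hq : (0 : ℝ) < (m : ℝ) := by exact_mod_cast hm
  have hroot : ∀ y : ℝ, 0 ≤ y → (y ^ (m : ℝ)) ^ ((1 : ℝ) / m) = y := fun y hy => by
    rw [← Real.rpow_mul hy, mul_one_div_cancel hq.ne', Real.rpow_one]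
  rcases lt_trichotomy x 0 with h | rfl | h
  · have hn : ¬ Even m.num := fun he => absurd (hx he) (not_le.2 h)
    have hp : 0 < (-x) ^ (m : ℝ) := Real.rpow_pos_of_pos (by linarith) _
    rw [ratPow, if_neg hn, Real.sign_of_neg h, abs_of_neg h, ratRoot,
      Real.sign_of_neg (by linarith), abs_of_neg (by linarith),
      show -(-1 * (-x) ^ (m : ℝ)) = (-x) ^ (m : ℝ) by ring, hroot _ (by linarith)]
    ring
  · have : ratPow 0 m = 0 := by simp [ratPow, hq.ne']
    simp [this, ratRoot]
  · have hp : 0 < x ^ (m : ℝ) := Real.rpow_pos_of_pos h _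
    have : ratPow x m = x ^ (m : ℝ) := by
      rw [ratPow, Real.sign_of_pos h, abs_of_pos h]; simp
    rw [this, ratRoot, Real.sign_of_pos hp, abs_of_pos hp, hroot _ h.le, one_mul]

/-! ### Riemann sums of a smooth integrand against a continuous path -/

lemma sum_range_by_parts (f g : ℕ → ℝ) (N : ℕ) :
    ∑ i ∈ Finset.range N, f i * (g (i + 1) - g i)
      = f N * g N - f 0 * g 0 - ∑ i ∈ Finset.range N, g (i + 1) * (f (i + 1) - f i) := by
  induction N with
  | zero => simp
  | succ N ih => rw [Finset.sum_range_succ, Finset.sum_range_succ, ih]; ring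

/-- Summation by parts moves the increments from the rough path `w` to the smooth `S`. What remains
is a Riemann–Stieltjes sum for `∫ w dS`, controlled by the uniform continuity of `w` on `[0, t]`. -/
lemma tendsto_riemannSum {S D w : ℝ → ℝ} (hS : ∀ s, HasDerivAt S (D s) s) (hD : Continuous D)
    (hw : Continuous w) {t : ℝ} (ht : 0 ≤ t) :
    Tendsto (fun N : ℕ => ∑ i ∈ Finset.range N,
        S (i * t / N) * (w ((i + 1) * t / N) - w (i * t / N))) atTop
      (𝓝 (S t * w t - S 0 * w 0 - ∫ s in (0 : ℝ)..t, D s * w s)) := by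
  obtain ⟨C, hC⟩ := (isCompact_Icc (a := (0 : ℝ)) (b := t)).exists_bound_of_continuousOn
    hD.continuousOn
  have huc : UniformContinuousOn w (Icc 0 t) :=
    isCompact_Icc.uniformContinuousOn_of_continuous hw.continuousOn
  rw [Metric.tendsto_atTop]
  intro ε hε
  have hC0 : 0 ≤ C := (norm_nonneg _).trans (hC 0 ⟨le_rfl, ht⟩)
  -- The `N` cells of length `t / N` contribute at most `C t ε / (C t + 1)` in total; the `+ 1`
  -- keeps this strictly below `ε` and the denominator positive.
  obtain ⟨δ, hδ, hδw⟩ := Metric.uniformContinuousOn_iff.1 huc (ε / (C * t + 1)) (by positivity)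
  obtain ⟨N₀, hN₀⟩ := exists_nat_gt (t / δ)
  refine ⟨N₀ + 1, fun N hN => ?_⟩
  have hNpos : (0 : ℝ) < N := by exact_mod_cast (show 0 < N by omega)
  have hmesh : t / N < δ := by
    have : (N₀ : ℝ) ≤ N := by exact_mod_cast (show N₀ ≤ N by omega)
    rw [div_lt_iff₀ hδ] at hN₀
    rw [div_lt_iff₀ hNpos]
    nlinarith
  have key := sum_range_by_parts (fun i => S (i * t / N)) (fun i => w (i * t / N)) N
  simp only [Nat.cast_add, Nat.cast_one, Nat.cast_zero, zero_mul, zero_div] at key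
  rw [mul_div_assoc (N : ℝ), mul_div_cancel₀ _ hNpos.ne'] at key
  rw [key, Real.dist_eq]
  have hint : ∀ f : ℝ → ℝ, Continuous f → ∀ a b : ℝ, IntervalIntegrable f volume a b :=
    fun f hf a b => hf.intervalIntegrable a b
  have hsum : ∫ s in (0 : ℝ)..t, D s * w s
      = ∑ i ∈ Finset.range N, ∫ s in (i * t / N)..((i + 1) * t / N), D s * w s := by
    have := intervalIntegral.sum_integral_adjacent_intervals (μ := volume)
      (f := fun s => D s * w s) (a := fun i : ℕ => (i : ℝ) * t / N) (n := N)
      fun k _ => hint _ (hD.mul hw) _ _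
    simp only [Nat.cast_add, Nat.cast_one, Nat.cast_zero, zero_mul, zero_div] at this
    rw [this, mul_div_assoc (N : ℝ), mul_div_cancel₀ _ hNpos.ne']
  have hFTC : ∀ i : ℕ, S ((i + 1) * t / N) - S (i * t / N)
      = ∫ s in (i * t / N)..((i + 1) * t / N), D s := fun i =>
    (intervalIntegral.integral_eq_sub_of_hasDerivAt (fun x _ => hS x) (hint _ hD _ _)).symm
  have hbound : ∀ i ∈ Finset.range N,
      |(∫ s in (i * t / N)..((i + 1) * t / N), D s * w s)
        - w ((i + 1) * t / N) * (S ((i + 1) * t / N) - S (i * t / N))|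
      ≤ C * (ε / (C * t + 1)) * (t / N) := by
    intro i hi
    have hiN : (i : ℝ) + 1 ≤ N := by
      have := Finset.mem_range.1 hi
      exact_mod_cast this
    have hle : (i : ℝ) * t / N ≤ (i + 1) * t / N := by gcongr; linarith
    have h0 : 0 ≤ (i : ℝ) * t / N := by positivity
    have h1 : ((i : ℝ) + 1) * t / N ≤ t := by
      rw [div_le_iff₀ hNpos]; nlinarith
    have hlen : ((i : ℝ) + 1) * t / N - i * t / N = t / N := by ring
    rw [hFTC, ← intervalIntegral.integral_const_mul, ← intervalIntegral.integral_sub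
      (hint (fun s => D s * w s) (hD.mul hw) _ _) (hint _ (hD.const_mul _) _ _)]
    have := intervalIntegral.norm_integral_le_of_norm_le_const
      (a := i * t / N) (b := (i + 1) * t / N) (C := C * (ε / (C * t + 1)))
      (f := fun s => D s * w s - w ((i + 1) * t / N) * D s) (fun s hs => ?_)
    · rwa [hlen, abs_of_nonneg (by positivity : 0 ≤ t / N)] at this
    · rw [uIoc_of_le hle] at hs
      have hsI : s ∈ Icc 0 t := ⟨h0.trans hs.1.le, hs.2.trans h1⟩
      rw [show D s * w s - w ((i + 1) * t / N) * D s = D s * (w s - w ((i + 1) * t / N)) by ring,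
        norm_mul]
      refine mul_le_mul (hC s hsI) ?_ (norm_nonneg _) hC0
      refine (hδw s hsI _ ⟨h0.trans hle, h1⟩ ?_).le
      rw [Real.dist_eq, abs_lt]
      constructor <;> linarith [hs.1, hs.2]
  have e : S t * w t - S 0 * w 0
        - ∑ i ∈ Finset.range N, w ((i + 1) * t / N) * (S ((i + 1) * t / N) - S (i * t / N))
        - (S t * w t - S 0 * w 0 - ∫ s in (0 : ℝ)..t, D s * w s)
      = ∑ i ∈ Finset.range N, ((∫ s in (i * t / N)..((i + 1) * t / N), D s * w s)
        - w ((i + 1) * t / N) * (S ((i + 1) * t / N) - S (i * t / N))) := by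
    rw [Finset.sum_sub_distrib, hsum]; ring
  rw [e]
  refine ((Finset.abs_sum_le_sum_abs _ _).trans (Finset.sum_le_sum hbound)).trans_lt ?_
  rw [Finset.sum_const, Finset.card_range, nsmul_eq_mul]
  have : (N : ℝ) * (C * (ε / (C * t + 1)) * (t / N)) = ε * (C * t / (C * t + 1)) := by
    field_simp
  rw [this]
  have h2 : C * t / (C * t + 1) < 1 := by
    rw [div_lt_one (by positivity)]; linarith
  nlinarith

/-! ### The linear equation -/

lemma eq_of_linear_ode {α d : ℝ → ℝ} (hα : Continuous α)
    (hd : ∀ t, 0 ≤ t → HasDerivAt d (α t * d t) t) (h0 : d 0 = 0) {t : ℝ} (ht : 0 ≤ t) :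
    d t = 0 := by
  have hQ : ∀ s, HasDerivAt (fun s => ∫ v in (0 : ℝ)..s, α v) (α s) s := fun s =>
    (hα.integral_hasStrictDerivAt 0 s).hasDerivAt
  have hf : ∀ s, 0 ≤ s →
      HasDerivAt (fun s => Real.exp (-∫ v in (0 : ℝ)..s, α v) * d s) 0 s := by
    intro s hs
    have := ((hQ s).neg.exp).mul (hd s hs)
    refine this.congr_deriv ?_
    simp only [Pi.neg_apply]
    ring
  have := constant_of_has_deriv_right_zero (a := 0) (b := t)
    (fun s hs => (hf s hs.1).continuousAt.continuousWithinAt)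
    (fun s hs => (hf s hs.1).hasDerivWithinAt) t ⟨ht, le_rfl⟩
  simp only [h0, mul_zero] at this
  exact (mul_eq_zero.1 this).resolve_left (Real.exp_ne_zero _)

/-- Neither `p` nor `w` need be differentiable, but `y = p - S w` is: `y' = α p - D w`. The
candidate `S (X - t/2)` for `y` satisfies the same equation, so the difference `d` solves `d' = α d`
with `d(0) = 0`. -/
lemma linear_solution {α S D q w p : ℝ → ℝ} (hα : Continuous α) (hS : ∀ s, HasDerivAt S (D s) s)
    (hD : Continuous D) (hS0 : S 0 ≠ 0) (hq : Continuous q)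
    (hqS : ∀ s, 0 ≤ s → q s * S s = D s - α s * S s) (hw : Continuous w) (hp : Continuous p)
    (hpt : ∀ t, 0 ≤ t →
      p t = p 0 + (∫ s in (0 : ℝ)..t, α s * p s) + (S t * w t - ∫ s in (0 : ℝ)..t, D s * w s))
    {t : ℝ} (ht : 0 ≤ t) :
    p t = S t * (Real.exp (-∫ s in (0 : ℝ)..t, q s) *
        (1 / 2 * (∫ s in (0 : ℝ)..t, Real.exp (∫ v in (0 : ℝ)..s, q v) *
          (1 - q s * (2 * w s - s))) + p 0 * (S 0)⁻¹) + w t - t / 2) := by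
  have hQ : ∀ s, HasDerivAt (fun s => ∫ v in (0 : ℝ)..s, q v) (q s) s := fun s =>
    (hq.integral_hasStrictDerivAt 0 s).hasDerivAt
  have hQc : Continuous fun s => ∫ v in (0 : ℝ)..s, q v :=
    continuous_iff_continuousAt.2 fun s => (hQ s).continuousAt
  set E : ℝ → ℝ := fun s => Real.exp (∫ v in (0 : ℝ)..s, q v) * (1 - q s * (2 * w s - s)) with hE
  have hEc : Continuous E := by fun_prop
  set X : ℝ → ℝ := fun t => Real.exp (-∫ s in (0 : ℝ)..t, q s) *
    (1 / 2 * (∫ s in (0 : ℝ)..t, E s) + p 0 * (S 0)⁻¹) with hX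
  have hXd : ∀ t, HasDerivAt X (-q t * X t + 1 / 2 * (1 - q t * (2 * w t - t))) t := by
    intro t
    have := ((hQ t).neg.exp).mul
      ((((hEc.integral_hasStrictDerivAt 0 t).hasDerivAt).const_mul (1 / 2)).add_const
        (p 0 * (S 0)⁻¹))
    refine this.congr_deriv ?_
    simp only [hX, hE, Pi.neg_apply]
    have h1 : Real.exp (-∫ s in (0 : ℝ)..t, q s) * Real.exp (∫ s in (0 : ℝ)..t, q s) = 1 := by
      rw [← Real.exp_add]; simp
    linear_combination ((1 / 2) * (1 - q t * (2 * w t - t))) * h1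
  have hg : Continuous fun s => α s * p s - D s * w s := by fun_prop
  -- The integral expression for `y` is differentiable on all of `ℝ`, whereas the equation for `p`
  -- holds only for `t ≥ 0`; thus two-sided derivatives exist at `0` too.
  have hy : ∀ t, HasDerivAt (fun t => p 0 + ∫ s in (0 : ℝ)..t, (α s * p s - D s * w s))
      (α t * p t - D t * w t) t := fun t =>
    ((hg.integral_hasStrictDerivAt 0 t).hasDerivAt).const_add _
  have hyp : ∀ t, 0 ≤ t →
      p 0 + ∫ s in (0 : ℝ)..t, (α s * p s - D s * w s) = p t - S t * w t := by
    intro t ht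
    have h1 : IntervalIntegrable (fun s => α s * p s) volume 0 t :=
      (hα.mul hp).intervalIntegrable _ _
    have h2 : IntervalIntegrable (fun s => D s * w s) volume 0 t :=
      (hD.mul hw).intervalIntegrable _ _
    rw [intervalIntegral.integral_sub h1 h2, hpt t ht]
    ring
  have hd := eq_of_linear_ode
    (d := fun t => S t * (X t - t / 2) - (p 0 + ∫ s in (0 : ℝ)..t, (α s * p s - D s * w s)))
    hα ?_ ?_ ht
  · rw [hyp t ht] at hd
    change p t = S t * (X t + w t - t / 2)
    linear_combination -hd
  · intro t ht
    have := ((hS t).mul ((hXd t).sub ((hasDerivAt_id t).div_const 2))).sub (hy t)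
    refine this.congr_deriv ?_
    simp only [hyp t ht, id, Pi.sub_apply]
    linear_combination (t / 2 - X t - w t) * hqS t ht
  · simp only [hX, intervalIntegral.integral_same, neg_zero, Real.exp_zero]
    field_simp
    ring

/-! ### The solution along a path -/

/-- Integrating `σ'`, frozen at its value at `0` for negative times, extends `σ` to a `C¹` function
on the line, affine on the negative half-line. -/
lemma exists_deriv_extension {σ : ℝ → ℝ} (hσ : ContDiffOn ℝ 1 σ (Ici 0)) :
    ∃ S : ℝ → ℝ, (∀ s, HasDerivAt S (derivWithin σ (Ici 0) (max s 0)) s) ∧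
      (∀ s, 0 ≤ s → S s = σ s) ∧
      Continuous fun s => derivWithin σ (Ici 0) (max s 0) := by
  have hD : Continuous fun s => derivWithin σ (Ici 0) (max s 0) :=
    continuous_comp_max (hσ.continuousOn_derivWithin (uniqueDiffOn_Ici 0) le_rfl)
  have hd : ∀ s, HasDerivAt (fun s => σ 0 + ∫ v in (0 : ℝ)..s, derivWithin σ (Ici 0) (max v 0))
      (derivWithin σ (Ici 0) (max s 0)) s := fun s =>
    ((hD.integral_hasStrictDerivAt 0 s).hasDerivAt).const_add _
  refine ⟨_, hd, fun s hs => ?_, hD⟩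
  rw [intervalIntegral.integral_eq_sub_of_hasDeriv_right_of_le hs
    (hσ.continuousOn.mono Icc_subset_Ici_self) (fun x hx => ?_) (hD.intervalIntegrable _ _)]
  · ring
  · rw [max_eq_left hx.1.le]
    exact ((hσ.differentiableOn one_ne_zero x hx.1.le).hasDerivWithinAt).mono
      (Ioi_subset_Ici hx.1.le)

section Pathwise

variable {Ω : Type*} {mΩ : MeasurableSpace Ω} {P : Measure Ω} {𝓕 : Filtration ℝ≥0 mΩ}
  {W R p : ℝ≥0 → Ω → ℝ} {m n : ℚ} {a c σ : ℝ → ℝ} {A B : ℝ}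

lemma InterestRate.IsWiener.measurable (hW : IsWiener 𝓕 W P) (t : ℝ≥0) : Measurable (W t) :=
  ((hW.adapted t).mono (𝓕.le t)).measurable

lemma InterestRate.IsWiener.isProbabilityMeasure (hW : IsWiener 𝓕 W P) : IsProbabilityMeasure P :=
  hW.brownian.isGaussianProcess.isProbabilityMeasure

lemma InterestRate.IsSolution.momentum_eq_ae (hW : IsWiener 𝓕 W P)
    (h : IsSolution 𝓕 W P m n 0 1 a (fun _ => 0) c σ R p) (hσ : ContDiffOn ℝ 1 σ (Ici 0))
    (t : ℝ≥0) :
    ∀ᵐ ω ∂P, p t ω = p 0 ω + (∫ s in (0 : ℝ)..t, a (max s 0) * p s.toNNReal ω)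
      + (σ t * W t ω - ∫ s in (0 : ℝ)..t,
          derivWithin σ (Ici 0) (max s 0) * W s.toNNReal ω) := by
  have := hW.isProbabilityMeasure
  obtain ⟨S, hS, hSσ, hD⟩ := exists_deriv_extension hσ
  have h1 := (h.eq_p t).tendsto
  simp only [ratPow_zero_right, mul_one, ratPow_one_right, zero_mul, add_zero] at h1
  have h2 : TendstoInMeasure P (fun (N : ℕ) (ω : Ω) => ∑ i ∈ Finset.range N,
      σ ((i : ℝ≥0) * t / N : ℝ≥0) * (W (((i : ℝ≥0) + 1) * t / N) ω - W ((i : ℝ≥0) * t / N) ω))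
      atTop (fun ω => σ t * W t ω - ∫ s in (0 : ℝ)..t,
          derivWithin σ (Ici 0) (max s 0) * W s.toNNReal ω) := by
    refine tendstoInMeasure_of_tendsto_ae (fun N => ?_) ?_
    · refine Measurable.aestronglyMeasurable (Finset.measurable_fun_sum _ fun i _ => ?_)
      exact ((hW.measurable _).sub (hW.measurable _)).const_mul _
    · filter_upwards [hW.brownian.cont, hW.brownian.eval_zero_ae_eq_zero] with ω hc h0
      have hw : Continuous fun s : ℝ => W s.toNNReal ω := hc.comp continuous_real_toNNReal
      have := tendsto_riemannSum hS hD hw t.2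
      simp only [NNReal.val_eq_coe, Real.toNNReal_coe, Real.toNNReal_zero, h0, mul_zero,
        sub_zero, hSσ t t.2] at this
      refine this.congr fun N => Finset.sum_congr rfl fun i _ => ?_
      have e1 : (i : ℝ) * t / N = ((i : ℝ≥0) * t / N : ℝ≥0) := by push_cast; rfl
      have e2 : ((i : ℝ) + 1) * t / N = (((i : ℝ≥0) + 1) * t / N : ℝ≥0) := by push_cast; rfl
      rw [e1, e2, Real.toNNReal_coe, Real.toNNReal_coe, hSσ _ (NNReal.coe_nonneg _)]
  filter_upwards [tendstoInMeasure_ae_unique h1 h2] with ω hω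
  rw [← hω]
  have : ∫ s in (0 : ℝ)..t, a (max s 0) * p s.toNNReal ω
      = ∫ s in (0 : ℝ)..t, a s * p s.toNNReal ω := by
    refine intervalIntegral.integral_congr fun s hs => ?_
    rw [uIcc_of_le t.coe_nonneg] at hs
    simp [max_eq_left hs.1]
  rw [this]
  ring

lemma continuous_primitive_of_continuous {f : ℝ → ℝ} (hf : Continuous f) :
    Continuous fun t => ∫ s in (0 : ℝ)..t, f s :=
  continuous_iff_continuousAt.2 fun t => (hf.integral_hasStrictDerivAt 0 t).hasDerivAt.continuousAt

lemma InterestRate.IsSolution.momentum_eq (hW : IsWiener 𝓕 W P)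
    (h : IsSolution 𝓕 W P m n 0 1 a (fun _ => 0) c σ R p) (ha : ContinuousOn a (Ici 0))
    (hσ : ContDiffOn ℝ 1 σ (Ici 0)) :
    ∀ᵐ ω ∂P, ∀ t : ℝ≥0, p t ω = p 0 ω + (∫ s in (0 : ℝ)..t, a (max s 0) * p s.toNNReal ω)
      + (σ t * W t ω - ∫ s in (0 : ℝ)..t,
          derivWithin σ (Ici 0) (max s 0) * W s.toNNReal ω) := by
  obtain ⟨-, -, -, hD⟩ := exists_deriv_extension hσ
  -- The exceptional null set depends on `t`; countably many dense times share one, and continuity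
  -- of both sides gives the rest.
  have hd : ∀ᵐ ω ∂P, ∀ k : ℕ, _ := ae_all_iff.2 fun k : ℕ =>
    momentum_eq_ae hW h hσ (TopologicalSpace.denseSeq ℝ≥0 k)
  filter_upwards [hd, hW.brownian.cont, h.cont_p] with ω hω hWc hpc
  have hw : Continuous fun s : ℝ => W s.toNNReal ω := hWc.comp continuous_real_toNNReal
  have hp : Continuous fun s : ℝ => p s.toNNReal ω := hpc.comp continuous_real_toNNReal
  have hσc : Continuous fun t : ℝ≥0 => σ t :=
    hσ.continuousOn.comp_continuous NNReal.continuous_coe fun t => t.2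
  have h1 : Continuous fun t : ℝ≥0 => ∫ s in (0 : ℝ)..t, a (max s 0) * p s.toNNReal ω :=
    (continuous_primitive_of_continuous ((continuous_comp_max ha).mul hp)).comp
      NNReal.continuous_coe
  have h2 : Continuous fun t : ℝ≥0 => ∫ s in (0 : ℝ)..t,
      derivWithin σ (Ici 0) (max s 0) * W s.toNNReal ω :=
    (continuous_primitive_of_continuous (hD.mul hw)).comp NNReal.continuous_coe
  refine congrFun ((TopologicalSpace.denseRange_denseSeq ℝ≥0).equalizer hpc ?_ (funext hω))
  exact (continuous_const.add h1).add ((hσc.mul hWc).sub h2)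

/-- The integral equation has right derivative `c(0) p₀ ^ m` at `0`, and right derivatives are
unique. Inverting the power needs the sign condition on `p₀` exactly when the numerator is even. -/
lemma InterestRate.IsCauchySolution.initial_momentum (hm : 0 < m) (hc : ContinuousOn c (Ici 0))
    (hc0 : c 0 ≠ 0) {k l : ℚ} {b : ℝ → ℝ}
    (h : IsCauchySolution 𝓕 W P m n k l a b c σ A B R p) :
    ∀ᵐ ω ∂P, p 0 ω = ratRoot (B / c 0) m := by
  have hroot : ∀ᵐ ω ∂P, Even m.num → 0 ≤ p 0 ω := by
    by_cases he : Even m.num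
    · filter_upwards [h.root he] with ω hω _ using hω
    · exact ae_of_all _ fun ω he' => absurd he' he
  filter_upwards [h.cont_p, h.eq_r, h.init_deriv, hroot] with ω hpc hr hB hpos
  have hg : Continuous fun s : ℝ => c (max s 0) * ratPow (p s.toNNReal ω) m :=
    (continuous_comp_max hc).mul ((continuous_ratPow hm).comp
      (hpc.comp continuous_real_toNNReal))
  have hd : HasDerivWithinAt (fun t : ℝ => R t.toNNReal ω) (c 0 * ratPow (p 0 ω) m) (Ici 0) 0 := by
    have h1 := (((hg.integral_hasStrictDerivAt 0 0).hasDerivAt).const_add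
      (R 0 ω)).hasDerivWithinAt (s := Ici 0)
    simp only [max_self, Real.toNNReal_zero] at h1
    refine h1.congr_of_mem (fun t ht => ?_) (mem_Ici.2 le_rfl)
    rw [hr, Real.coe_toNNReal _ ht]
    congr 1
    refine intervalIntegral.integral_congr fun s hs => ?_
    rw [uIcc_of_le ht] at hs
    simp [max_eq_left hs.1]
  have hu := (uniqueDiffWithinAt_Ici (0 : ℝ)).eq_deriv _ hB hd
  rw [hu, mul_div_cancel_left₀ _ hc0, ratRoot_ratPow hm hpos]

lemma InterestRate.IsCauchySolution.eq_explicitSolution (hm : 0 < m) (hc : ContinuousOn c (Ici 0))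
    (hc0 : c 0 ≠ 0) (ha : ContinuousOn a (Ici 0)) (hσ : ContDiffOn ℝ 1 σ (Ici 0))
    (hσ0 : ∀ t, 0 ≤ t → 0 < σ t) (hW : IsWiener 𝓕 W P)
    (h : IsCauchySolution 𝓕 W P m n 0 1 a (fun _ => 0) c σ A B R p) :
    ∀ᵐ ω ∂P, ∀ t : ℝ≥0, R t ω = explicitSolution m a c σ A B (fun s => W s ω) t := by
  obtain ⟨S, hS, hSσ, hD⟩ := exists_deriv_extension hσ
  filter_upwards [IsSolution.momentum_eq hW h.toIsSolution ha hσ,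
    IsCauchySolution.initial_momentum hm hc hc0 h, hW.brownian.cont, h.cont_p, h.eq_r,
    h.init] with ω hpt hp0 hWc hpc hr hR0 t
  have hw : Continuous fun s : ℝ => W s.toNNReal ω := hWc.comp continuous_real_toNNReal
  have hp : Continuous fun s : ℝ => p s.toNNReal ω := hpc.comp continuous_real_toNNReal
  have hq : Continuous fun s => rate a σ (max s 0) := by
    refine (hD.div (continuous_comp_max hσ.continuousOn) fun s => ?_).sub (continuous_comp_max ha)
    exact (hσ0 _ (le_max_right s 0)).ne'
  have hsol : ∀ u : ℝ, 0 ≤ u → _ := fun u hu =>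
    linear_solution (t := u) (continuous_comp_max ha) hS hD
    (by rw [hSσ 0 le_rfl]; exact (hσ0 0 le_rfl).ne') hq
    (fun s hs => by
      have := (hσ0 s hs).ne'
      simp only [rate, max_eq_left hs, hSσ s hs]
      field_simp) hw hp
    (fun s hs => by
      have := hpt s.toNNReal
      rw [Real.coe_toNNReal _ hs] at this
      simp only [Real.toNNReal_zero, hSσ s hs]
      exact this) hu
  rw [hr t, hR0, explicitSolution]
  congr 1
  refine intervalIntegral.integral_congr fun u hu => ?_
  rw [uIcc_of_le t.coe_nonneg] at hu
  have hint : ∀ s, 0 ≤ s → ∫ v in (0 : ℝ)..s, rate a σ (max v 0) = ∫ v in (0 : ℝ)..s, rate a σ v := by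
    intro s hs
    refine intervalIntegral.integral_congr fun v hv => ?_
    rw [uIcc_of_le hs] at hv
    simp [max_eq_left hv.1]
  have hint2 : ∫ s in (0 : ℝ)..u, Real.exp (∫ v in (0 : ℝ)..s, rate a σ (max v 0)) *
      (1 - rate a σ (max s 0) * (2 * W s.toNNReal ω - s))
      = ∫ s in (0 : ℝ)..u, Real.exp (∫ v in (0 : ℝ)..s, rate a σ v) *
        (1 + (-(derivWithin σ (Ici 0) s / σ s) + a s) * (2 * W s.toNNReal ω - s)) := by
    refine intervalIntegral.integral_congr fun s hs => ?_
    rw [uIcc_of_le hu.1] at hs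
    simp only [hint s hs.1, max_eq_left hs.1]
    congr 1
    rw [rate]; ring
  have hu' := hsol u hu.1
  rw [hint u hu.1, hint2, hSσ u hu.1, hSσ 0 le_rfl, Real.toNNReal_zero, hp0] at hu'
  rw [hu', ratPow_mul_of_pos m (hσ0 u hu.1)]
  ring

lemma InterestRate.IsCauchySolution.eq_integral_pow {m : ℕ} (hm : 0 < m) (hc : ContinuousOn c (Ici 0))
    (hc0 : c 0 ≠ 0) {σ : ℝ} (hW : IsWiener 𝓕 W P)
    (h : IsCauchySolution 𝓕 W P m n 0 1 (fun _ => 0) (fun _ => 0) c (fun _ => σ) A B R p) :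
    ∀ᵐ ω ∂P, ∀ t : ℝ≥0, R t ω
      = A + ∫ u in (0 : ℝ)..t, c u * (ratRoot (B / c 0) m + σ * W u.toNNReal ω) ^ m := by
  filter_upwards [IsSolution.momentum_eq hW h.toIsSolution continuousOn_const contDiffOn_const,
    IsCauchySolution.initial_momentum (by exact_mod_cast hm) hc hc0 h, h.eq_r, h.init]
    with ω hpt hp0 hr hR0 t
  rw [hr t, hR0]
  congr 1
  refine intervalIntegral.integral_congr fun u hu => ?_
  have := hpt u.toNNReal
  simp only [zero_mul, derivWithin_fun_const, Pi.zero_apply, intervalIntegral.integral_zero,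
    add_zero, sub_zero] at this
  simp only [ratPow_natCast, this, hp0]

end Pathwise

/-! ### Mean and variance -/

section Moments

variable {Ω : Type*} {mΩ : MeasurableSpace Ω} {P : Measure Ω} {𝓕 : Filtration ℝ≥0 mΩ}
  {W X R p : ℝ≥0 → Ω → ℝ} {c : ℝ → ℝ} {t : ℝ}

lemma intervalIntegrable_integrand (hc : ContinuousOn c (Ici 0))
    (hX : ∀ ω, Continuous fun t => X t ω) (ht : 0 ≤ t) (k : ℕ) (ω : Ω) :
    IntervalIntegrable (fun u => c u * X u.toNNReal ω ^ k) volume 0 t := by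
  refine ContinuousOn.intervalIntegrable ?_
  rw [uIcc_of_le ht]
  exact (hc.mono Icc_subset_Ici_self).mul
    (((hX ω).comp continuous_real_toNNReal).pow k).continuousOn

lemma integral_add_mul_pow_eq_sum (hc : ContinuousOn c (Ici 0))
    (hX : ∀ ω, Continuous fun t => X t ω) (ht : 0 ≤ t) (m : ℕ) (c₁ σ : ℝ) (ω : Ω) :
    ∫ u in (0 : ℝ)..t, c u * (c₁ + σ * X u.toNNReal ω) ^ m
      = ∑ k ∈ Finset.range (m + 1),
          (m.choose k * c₁ ^ (m - k)) * σ ^ k * powerIntegral c X t k ω := by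
  simp only [powerIntegral, ← intervalIntegral.integral_const_mul]
  rw [← intervalIntegral.integral_finsetSum fun k _ =>
    (intervalIntegrable_integrand hc hX ht k ω).const_mul _]
  refine intervalIntegral.integral_congr fun u _ => ?_
  rw [add_comm c₁, add_pow, Finset.mul_sum]
  refine Finset.sum_congr rfl fun k _ => ?_
  rw [mul_pow]; ring

lemma taylorProcess_eq (hc : ContinuousOn c (Ici 0)) (hX : ∀ ω, Continuous fun t => X t ω)
    (ht : 0 ≤ t) (m : ℕ) (A c₁ σ : ℝ) (ω : Ω) :
    taylorProcess m c A c₁ σ X t ω = (A + c₁ ^ m * ∫ u in (0 : ℝ)..t, c u)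
      + m * c₁ ^ (m - 1) * σ * powerIntegral c X t 1 ω := by
  have h0 := intervalIntegrable_integrand hc hX ht 0 ω
  have h1 := intervalIntegrable_integrand hc hX ht 1 ω
  simp only [pow_zero, mul_one, pow_one] at h0 h1
  rw [taylorProcess, add_assoc]
  congr 1
  simp only [powerIntegral, pow_one]
  rw [← intervalIntegral.integral_const_mul, ← intervalIntegral.integral_const_mul,
    ← intervalIntegral.integral_add (h0.const_mul _) (h1.const_mul _)]
  refine intervalIntegral.integral_congr fun u _ => ?_
  ring

lemma integral_powerIntegral_even (hB : IsPreBrownianReal X P) (hc : ContinuousOn c (Ici 0))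
    (hX : ∀ ω, Continuous fun t => X t ω) (hXm : ∀ t, Measurable (X t)) (ht : 0 ≤ t) (j : ℕ) :
    ∫ ω, powerIntegral c X t (2 * j) ω ∂P
      = ((2 * j)! : ℝ) / (2 ^ j * (j ! : ℝ)) * ∫ u in (0 : ℝ)..t, c u * u ^ j := by
  rw [integral_powerIntegral hB hc hX hXm ht, ← intervalIntegral.integral_const_mul,
    ← intervalIntegral.integral_const_mul]
  refine intervalIntegral.integral_congr fun u _ => ?_
  rw [gaussCoeff_even, div_pow]
  field_simp

lemma integral_powerIntegral_odd (hB : IsPreBrownianReal X P) (hc : ContinuousOn c (Ici 0))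
    (hX : ∀ ω, Continuous fun t => X t ω) (hXm : ∀ t, Measurable (X t)) (ht : 0 ≤ t) {k : ℕ}
    (hk : Odd k) : ∫ ω, powerIntegral c X t k ω ∂P = 0 := by
  rw [integral_powerIntegral hB hc hX hXm ht]
  simp only [gaussCoeff_odd _ (show Odd (k : ℤ) by exact_mod_cast hk)]
  simp

lemma integral_powerIntegral_eq_meanShift (hB : IsPreBrownianReal X P)
    (hc : ContinuousOn c (Ici 0)) (hX : ∀ ω, Continuous fun t => X t ω)
    (hXm : ∀ t, Measurable (X t)) (ht : 0 ≤ t) (m : ℕ) :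
    ∫ ω, powerIntegral c X t m ω ∂P = meanShift m c t := by
  rw [meanShift]
  split_ifs with h
  · obtain ⟨j, rfl⟩ := h.two_dvd
    rw [integral_powerIntegral_even hB hc hX hXm ht, Nat.mul_div_cancel_left _ two_pos]
  · exact integral_powerIntegral_odd hB hc hX hXm ht (Nat.not_even_iff_odd.1 h)

lemma sum_range_div_two {f : ℕ → ℝ} (hf : ∀ k, Odd k → f k = 0) (m : ℕ) :
    ∑ k ∈ Finset.range (m + 1), f k = ∑ j ∈ Finset.range (m / 2 + 1), f (2 * j) := by
  have h := sum_range_even (fun j => hf (2 * j + 1) ⟨j, rfl⟩) (m / 2)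
  rcases Nat.even_or_odd m with he | ho
  · rwa [Nat.two_mul_div_two_of_even he] at h
  · rw [Finset.sum_range_succ, hf m ho, add_zero, ← h, Nat.two_mul_div_two_add_one_of_odd ho]

lemma InterestRate.IsCauchySolution.exists_continuous_version {m : ℕ} (hm : 0 < m)
    (hc : ContinuousOn c (Ici 0)) (hc0 : c 0 ≠ 0) {n : ℚ} {σ A B : ℝ} (hW : IsWiener 𝓕 W P)
    (h : IsCauchySolution 𝓕 W P m n 0 1 (fun _ => 0) (fun _ => 0) c (fun _ => σ) A B R p) :
    ∃ X : ℝ≥0 → Ω → ℝ, IsPreBrownianReal X P ∧ (∀ ω, Continuous fun t => X t ω) ∧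
      (∀ t, Measurable (X t)) ∧ (∀ᵐ ω ∂P, ∀ t, X t ω = W t ω) ∧
      ∀ t : ℝ≥0, ∀ᵐ ω ∂P, R t ω
        = A + ∑ k ∈ Finset.range (m + 1), (m.choose k * ratRoot (B / c 0) m ^ (m - k)) * σ ^ k
          * powerIntegral c X t k ω := by
  obtain ⟨X, hB, hX, hXm, hXW⟩ := _root_.exists_continuous_version hW.brownian hW.measurable
  refine ⟨X, hB, hX, hXm, hXW, fun t => ?_⟩
  filter_upwards [hXW, h.eq_integral_pow hm hc hc0 hW] with ω h1 h2
  rw [h2 t, ← integral_add_mul_pow_eq_sum hc hX t.coe_nonneg]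
  simp only [h1]

lemma integral_solution (hB : IsPreBrownianReal X P)
    (hc : ContinuousOn c (Ici 0)) (hX : ∀ ω, Continuous fun t => X t ω)
    (hXm : ∀ t, Measurable (X t)) (ht : 0 ≤ t) (A : ℝ) (b : ℕ → ℝ) (m : ℕ) :
    MemLp (fun ω => A + ∑ k ∈ Finset.range (m + 1), b k * powerIntegral c X t k ω) 2 P ∧
    ∫ ω, (A + ∑ k ∈ Finset.range (m + 1), b k * powerIntegral c X t k ω) ∂P
      = A + ∑ j ∈ Finset.range (m / 2 + 1), b (2 * j) *
        (((2 * j)! : ℝ) / (2 ^ j * (j ! : ℝ)) * ∫ u in (0 : ℝ)..t, c u * u ^ j) := by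
  have := hB.isGaussianProcess.isProbabilityMeasure
  have hZ := memLp_powerIntegral hB hc hX hXm ht
  have hi : ∀ k, Integrable (fun ω => b k * powerIntegral c X t k ω) P := fun k =>
    ((hZ k).integrable one_le_two).const_mul _
  refine ⟨(memLp_const A).add (memLp_finsetSum _ fun k _ => (hZ k).const_mul _), ?_⟩
  rw [integral_add (integrable_const _) (integrable_finsetSum _ fun k _ => hi k),
    integral_finsetSum _ fun k _ => hi k]
  simp only [integral_const_mul, integral_const, probReal_univ, one_smul]
  rw [sum_range_div_two fun k hk => by
    rw [integral_powerIntegral_odd hB hc hX hXm ht hk, mul_zero]]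
  simp only [integral_powerIntegral_even hB hc hX hXm ht]

end Moments

/-! ### First-order Taylor approximation -/

section Taylor

/-- A bound of the mean square of the Taylor remainder divided by `σ ^ 4`. -/
noncomputable def remainderBound (m : ℕ) (b M : ℕ → ℝ) (σ₀ : ℝ) : ℝ :=
  (Finset.Icc 2 m).card * ∑ k ∈ Finset.Icc 2 m, b k ^ 2 * (σ₀ ^ (k - 2)) ^ 2 * M k

/-- A bound of the covariance of the Taylor polynomial and the remainder, divided by `σ ^ 4`. -/
noncomputable def crossBound (m : ℕ) (α : ℝ) (b M : ℕ → ℝ) (σ₀ : ℝ) : ℝ :=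
  ∑ k ∈ Finset.Icc 2 m, |α| * |b k| * σ₀ ^ (k - 3) * ((M 1 + M k) / 2)

variable {Ω : Type*} {mΩ : MeasurableSpace Ω} {P : Measure Ω}
  {Z : ℕ → Ω → ℝ} {b M : ℕ → ℝ} {σ σ₀ : ℝ}

/-- Cauchy–Schwarz for the finite sum leaves the diagonal terms, and `σ^(2k) ≤ σ₀^(2(k-2)) σ⁴` for
`k ≥ 2`. -/
lemma integral_remainder_sq_le (hZ : ∀ k, MemLp (Z k) 2 P) (hM : ∀ k, ∫ ω, Z k ω ^ 2 ∂P ≤ M k)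
    (hσ : 0 < σ) (hσ₀ : σ ≤ σ₀) (m : ℕ) :
    ∫ ω, (∑ k ∈ Finset.Icc 2 m, b k * σ ^ k * Z k ω) ^ 2 ∂P ≤ remainderBound m b M σ₀ * σ ^ 4 := by
  have hi : ∀ k, Integrable (fun ω => (b k * σ ^ k * Z k ω) ^ 2) P := fun k =>
    ((hZ k).const_mul _).integrable_sq
  have h1 : ∫ ω, (∑ k ∈ Finset.Icc 2 m, b k * σ ^ k * Z k ω) ^ 2 ∂P
      ≤ ∫ ω, ((Finset.Icc 2 m).card : ℝ) * ∑ k ∈ Finset.Icc 2 m, (b k * σ ^ k * Z k ω) ^ 2 ∂P := by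
    refine integral_mono (memLp_finsetSum _ fun k _ => (hZ k).const_mul _).integrable_sq
      ((integrable_finsetSum _ fun k _ => hi k).const_mul _) fun ω => ?_
    exact sq_sum_le_card_mul_sum_sq
  refine h1.trans ?_
  rw [integral_const_mul, integral_finsetSum _ fun k _ => hi k, remainderBound, mul_assoc,
    Finset.sum_mul]
  gcongr with k hk
  have hk2 : 2 ≤ k := (Finset.mem_Icc.1 hk).1
  simp only [mul_pow, integral_const_mul]
  obtain ⟨j, rfl⟩ := Nat.exists_eq_add_of_le hk2
  rw [Nat.add_sub_cancel_left]
  have hMk : 0 ≤ ∫ ω, Z (2 + j) ω ^ 2 ∂P := integral_nonneg fun ω => sq_nonneg _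
  calc b (2 + j) ^ 2 * (σ ^ (2 + j)) ^ 2 * ∫ ω, Z (2 + j) ω ^ 2 ∂P
      = b (2 + j) ^ 2 * (σ ^ j) ^ 2 * (∫ ω, Z (2 + j) ω ^ 2 ∂P) * σ ^ 4 := by ring
    _ ≤ b (2 + j) ^ 2 * (σ₀ ^ j) ^ 2 * M (2 + j) * σ ^ 4 := by
      have := hM (2 + j)
      have h0 : 0 ≤ σ₀ := hσ.le.trans hσ₀
      gcongr

lemma abs_integral_mul_le_of_bound (hZ : ∀ k, MemLp (Z k) 2 P)
    (hM : ∀ k, ∫ ω, Z k ω ^ 2 ∂P ≤ M k) (j k : ℕ) :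
    |∫ ω, Z j ω * Z k ω ∂P| ≤ (M j + M k) / 2 := by
  refine (abs_integral_le_integral_abs).trans ((integral_abs_mul_le (hZ j).aestronglyMeasurable
    (hZ k).aestronglyMeasurable (hZ j).integrable_sq (hZ k).integrable_sq).trans ?_)
  linarith [hM j, hM k]

variable [IsProbabilityMeasure P]

lemma abs_covariance_remainder_le (hZ : ∀ k, MemLp (Z k) 2 P)
    (hM : ∀ k, ∫ ω, Z k ω ^ 2 ∂P ≤ M k) (hZ1 : ∫ ω, Z 1 ω ∂P = 0)
    (hZ12 : ∫ ω, Z 1 ω * Z 2 ω ∂P = 0) (hσ : 0 < σ) (hσ₀ : σ ≤ σ₀) (m : ℕ) (κ α : ℝ) :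
    |cov[fun ω => κ + α * σ * Z 1 ω, fun ω => ∑ k ∈ Finset.Icc 2 m, b k * σ ^ k * Z k ω; P]|
      ≤ crossBound m α b M σ₀ * σ ^ 4 := by
  have e : cov[fun ω => κ + α * σ * Z 1 ω, fun ω => ∑ k ∈ Finset.Icc 2 m, b k * σ ^ k * Z k ω; P]
      = ∑ k ∈ Finset.Icc 2 m, α * σ * (b k * σ ^ k * ∫ ω, Z 1 ω * Z k ω ∂P) := by
    rw [covariance_const_add_left (((hZ 1).integrable one_le_two).const_mul _),
      covariance_const_mul_left, covariance_fun_sum_right' (fun k _ => (hZ k).const_mul _) (hZ 1),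
      Finset.mul_sum]
    refine Finset.sum_congr rfl fun k _ => ?_
    rw [covariance_const_mul_right, covariance_eq_sub (hZ 1) (hZ k), hZ1]
    simp
  have hM0 : ∀ k, 0 ≤ M k := fun k => (integral_nonneg fun ω => sq_nonneg _).trans (hM k)
  have h0 : 0 ≤ σ₀ := hσ.le.trans hσ₀
  rw [e, crossBound, Finset.sum_mul]
  refine (Finset.abs_sum_le_sum_abs _ _).trans (Finset.sum_le_sum fun k hk => ?_)
  have hk2 : 2 ≤ k := (Finset.mem_Icc.1 hk).1
  -- The term `k = 2` is of order `σ³` and must vanish; there the truncated exponent `k - 3 = 0`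
  -- only adds a nonnegative quantity to the bound. For `k ≥ 3` the order is at least `σ⁴`.
  rcases hk2.eq_or_lt with rfl | hk3
  · rw [hZ12]
    have := hM0 1
    have := hM0 2
    simp only [mul_zero, abs_zero]
    positivity
  · obtain ⟨j, rfl⟩ := Nat.exists_eq_add_of_le (show 3 ≤ k from hk3)
    rw [Nat.add_sub_cancel_left]
    simp only [abs_mul, abs_pow, abs_of_pos hσ]
    have h2 := abs_integral_mul_le_of_bound hZ hM 1 (3 + j)
    calc |α| * σ * (|b (3 + j)| * σ ^ (3 + j) * |∫ ω, Z 1 ω * Z (3 + j) ω ∂P|)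
        = |α| * |b (3 + j)| * σ ^ j * |∫ ω, Z 1 ω * Z (3 + j) ω ∂P| * σ ^ 4 := by ring
      _ ≤ |α| * |b (3 + j)| * σ₀ ^ j * ((M 1 + M (3 + j)) / 2) * σ ^ 4 := by gcongr

/-- With `D` the remainder, the difference of variances is `Var D + 2 Cov(T, D)`, and both parts are
`O(σ⁴)`. -/
lemma abs_variance_sub_le (hZ : ∀ k, MemLp (Z k) 2 P)
    (hM : ∀ k, ∫ ω, Z k ω ^ 2 ∂P ≤ M k) (hZ1 : ∫ ω, Z 1 ω ∂P = 0)
    (hZ12 : ∫ ω, Z 1 ω * Z 2 ω ∂P = 0) (hσ : 0 < σ) (hσ₀ : σ ≤ σ₀) (m : ℕ) (κ α : ℝ) :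
    |Var[fun ω => κ + α * σ * Z 1 ω + ∑ k ∈ Finset.Icc 2 m, b k * σ ^ k * Z k ω; P]
        - Var[fun ω => κ + α * σ * Z 1 ω; P]|
      ≤ (remainderBound m b M σ₀ + 2 * crossBound m α b M σ₀) * σ ^ 4 := by
  have hT : MemLp (fun ω => κ + α * σ * Z 1 ω) 2 P := (memLp_const κ).add ((hZ 1).const_mul _)
  have hD : MemLp (fun ω => ∑ k ∈ Finset.Icc 2 m, b k * σ ^ k * Z k ω) 2 P :=
    memLp_finsetSum _ fun k _ => (hZ k).const_mul _
  have h1 := abs_le.1 (abs_covariance_remainder_le (b := b) hZ hM hZ1 hZ12 hσ hσ₀ m κ α)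
  have h2 := (variance_le_expectation_sq hD.aestronglyMeasurable).trans
    (integral_remainder_sq_le (b := b) hZ hM hσ hσ₀ m)
  have h3 := variance_nonneg (fun ω => ∑ k ∈ Finset.Icc 2 m, b k * σ ^ k * Z k ω) P
  rw [variance_fun_add hT hD, abs_le]
  constructor <;> nlinarith [h1.1, h1.2]

lemma integral_sq_affine {f : Ω → ℝ} (hf : MemLp f 2 P) (h0 : ∫ ω, f ω ∂P = 0) (κ β : ℝ) :
    ∫ ω, (κ + β * f ω) ^ 2 ∂P = κ ^ 2 + β ^ 2 * ∫ ω, f ω * f ω ∂P := by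
  have h1 := hf.integrable one_le_two
  have h2 : Integrable (fun ω => f ω * f ω) P := hf.integrable_mul hf
  have h3 : Integrable (fun ω => κ ^ 2 + 2 * κ * β * f ω) P :=
    (integrable_const _).add (h1.const_mul _)
  have e : (fun ω => (κ + β * f ω) ^ 2)
      = fun ω => (κ ^ 2 + 2 * κ * β * f ω) + β ^ 2 * (f ω * f ω) := by
    ext ω; ring
  rw [e, integral_add h3 (h2.const_mul _),
    integral_add (integrable_const _) (h1.const_mul _), integral_const_mul, integral_const_mul, h0]
  simp

lemma variance_affine {f : Ω → ℝ} (hf : MemLp f 2 P) (κ β : ℝ) :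
    Var[fun ω => κ + β * f ω; P]
      = β ^ 2 * (∫ ω, f ω * f ω ∂P - (∫ ω, f ω ∂P) ^ 2) := by
  rw [variance_const_add (hf.const_mul β).aestronglyMeasurable, variance_const_mul,
    variance_eq_sub hf]
  simp [sq]

lemma sum_range_eq_add_sum_Icc (f : ℕ → ℝ) {m : ℕ} (hm : 0 < m) :
    ∑ k ∈ Finset.range (m + 1), f k = f 0 + f 1 + ∑ k ∈ Finset.Icc 2 m, f k := by
  rw [Finset.range_eq_Ico, Finset.sum_eq_sum_Ico_succ_bot (by omega),
    Finset.sum_eq_sum_Ico_succ_bot (by omega), ← add_assoc]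
  rfl

end Taylor

/-! ### The pathwise formula, the moments and the Taylor approximation -/

theorem lemma1 (c : ℝ → ℝ) (hc : ContinuousOn c (Ici 0)) (hc0 : c 0 ≠ 0) (B : ℝ) :
    -- pathwise formula
    (∀ (m : ℚ), 0 < m → ∀ (n : ℚ) (a σ : ℝ → ℝ) (A : ℝ),
      ContinuousOn a (Ici 0) → ContDiffOn ℝ 1 σ (Ici 0) → (∀ t, 0 ≤ t → 0 < σ t) →
      ∀ (Ω : Type v) (mΩ : MeasurableSpace Ω) (P : Measure Ω) (𝓕 : Filtration ℝ≥0 mΩ)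
        (W R p : ℝ≥0 → Ω → ℝ), IsWiener 𝓕 W P →
        IsCauchySolution 𝓕 W P m n 0 1 a (fun _ => 0) c σ A B R p →
        ∀ᵐ ω ∂P, ∀ t : ℝ≥0, R t ω = explicitSolution m a c σ A B (fun s => W s ω) t) ∧
    -- mean and variance for `B = 0`
    (B = 0 → ∀ (m : ℕ), 0 < m → ∀ (n : ℚ) (σ A : ℝ), 0 < σ →
      ∀ (Ω : Type v) (mΩ : MeasurableSpace Ω) (P : Measure Ω) (𝓕 : Filtration ℝ≥0 mΩ)
        (W R p : ℝ≥0 → Ω → ℝ), IsWiener 𝓕 W P →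
        IsCauchySolution 𝓕 W P m n 0 1 (fun _ => 0) (fun _ => 0) c (fun _ => σ) A B R p →
        ∀ t : ℝ≥0, MemLp (R t) 2 P ∧
          P[R t] = (if Even m then A + σ ^ m * meanShift m c t else A) ∧
          Var[R t; P] = σ ^ (2 * m) *
            ((∫ s in (0 : ℝ)..t, ∫ u in (0 : ℝ)..t, c s * c u * mixedKernel m s u)
              - meanShift m c t ^ 2)) ∧
    -- mean for `B ≠ 0`
    (B ≠ 0 → ∀ (m : ℕ), 0 < m → ∀ (n : ℚ) (σ A : ℝ), 0 < σ →
      ∀ (Ω : Type v) (mΩ : MeasurableSpace Ω) (P : Measure Ω) (𝓕 : Filtration ℝ≥0 mΩ)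
        (W R p : ℝ≥0 → Ω → ℝ), IsWiener 𝓕 W P →
        IsCauchySolution 𝓕 W P m n 0 1 (fun _ => 0) (fun _ => 0) c (fun _ => σ) A B R p →
        ∀ t : ℝ≥0, Integrable (R t) P ∧
          P[R t] = A + σ ^ m * ∑ j ∈ Finset.range (m / 2 + 1),
            (m.choose (m - 2 * j) : ℝ) * (ratRoot (B / c 0) m / σ) ^ (m - 2 * j)
              * (((2 * j)! : ℝ) / (2 ^ j * (j ! : ℝ))) * ∫ u in (0 : ℝ)..t, c u * u ^ j) ∧
    -- Taylor approximation of the variance for `B ≠ 0`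
    (B ≠ 0 → ∀ (m : ℕ), 0 < m → ∀ σ₀ T : ℝ, ∃ K : ℝ, ∀ (n : ℚ) (σ A : ℝ), 0 < σ → σ ≤ σ₀ →
      ∀ (Ω : Type v) (mΩ : MeasurableSpace Ω) (P : Measure Ω) (𝓕 : Filtration ℝ≥0 mΩ)
        (W R p : ℝ≥0 → Ω → ℝ), IsWiener 𝓕 W P →
        IsCauchySolution 𝓕 W P m n 0 1 (fun _ => 0) (fun _ => 0) c (fun _ => σ) A B R p →
        ∀ (c₁ : ℝ), c₁ = ratRoot (B / c 0) m → ∀ t : ℝ≥0, (t : ℝ) ≤ T →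
          MemLp (R t) 2 P ∧ MemLp (taylorProcess m c A c₁ σ W t) 2 P ∧
          P[fun ω => (R t ω - taylorProcess m c A c₁ σ W t ω) ^ 2] ≤ K * σ ^ 4 ∧
          P[fun ω => taylorProcess m c A c₁ σ W t ω ^ 2] =
            A ^ 2 + 2 * A * c₁ ^ m * (∫ u in (0 : ℝ)..t, c u)
              + c₁ ^ (2 * m) * (∫ u in (0 : ℝ)..t, c u) ^ 2
              + (m : ℝ) ^ 2 * σ ^ 2 * c₁ ^ (2 * m - 2) *
                ∫ u in (0 : ℝ)..t, ∫ s in (0 : ℝ)..t, c u * c s * min u s ∧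
          Var[taylorProcess m c A c₁ σ W t; P] = (m : ℝ) ^ 2 * σ ^ 2 * c₁ ^ (2 * m - 2) *
            ∫ u in (0 : ℝ)..t, ∫ s in (0 : ℝ)..t, c u * c s * min u s ∧
          |Var[R t; P] - (m : ℝ) ^ 2 * σ ^ 2 * c₁ ^ (2 * m - 2) *
            ∫ u in (0 : ℝ)..t, ∫ s in (0 : ℝ)..t, c u * c s * min u s| ≤ K * σ ^ 4) := by
  refine ⟨?_, ?_, ?_, ?_⟩
  · intro m hm n a σ A ha hσ hσ0 Ω mΩ P 𝓕 W R p hW h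
    exact h.eq_explicitSolution hm hc hc0 ha hσ hσ0 hW
  · rintro rfl m hm n σ A hσ Ω mΩ P 𝓕 W R p hW h t
    have := hW.isProbabilityMeasure
    obtain ⟨X, hB, hX, hXm, hXW, -⟩ := h.exists_continuous_version hm hc hc0 hW
    have hZ := memLp_powerIntegral hB hc hX hXm t.coe_nonneg m
    have hR : R t =ᵐ[P] fun ω => A + σ ^ m * powerIntegral c X t m ω := by
      filter_upwards [hXW, h.eq_integral_pow hm hc hc0 hW] with ω h1 h2
      rw [h2 t, powerIntegral, ← intervalIntegral.integral_const_mul]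
      congr 1
      refine intervalIntegral.integral_congr fun u _ => ?_
      simp only [h1, zero_div, ratRoot, Real.sign_zero, zero_mul, zero_add, mul_pow]
      ring
    refine ⟨((memLp_const A).add (hZ.const_mul _)).ae_eq hR.symm, ?_, ?_⟩
    · rw [integral_congr_ae hR, integral_add (integrable_const _)
        ((hZ.integrable one_le_two).const_mul _), integral_const_mul,
        integral_powerIntegral_eq_meanShift hB hc hX hXm t.coe_nonneg]
      split_ifs with he
      · simp
      · simp [meanShift, he]
    · rw [variance_congr hR, variance_affine hZ,
        integral_powerIntegral_eq_meanShift hB hc hX hXm t.coe_nonneg,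
        integral_powerIntegral_mul hB hc hX hXm t.coe_nonneg m m
          (hB.integral_pow_mul_pow_self hm)]
      ring
  · intro _ m hm n σ A hσ Ω mΩ P 𝓕 W R p hW h t
    have := hW.isProbabilityMeasure
    obtain ⟨X, hB, hX, hXm, -, hR⟩ := h.exists_continuous_version hm hc hc0 hW
    obtain ⟨h1, h2⟩ := integral_solution hB hc hX hXm t.coe_nonneg A
      (fun k => (m.choose k * ratRoot (B / c 0) m ^ (m - k)) * σ ^ k) m
    refine ⟨(h1.integrable one_le_two).congr (EventuallyEq.symm (hR t)), ?_⟩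
    rw [integral_congr_ae (hR t), h2, Finset.mul_sum]
    congr 1
    refine Finset.sum_congr rfl fun j hj => ?_
    have hj2 : 2 * j ≤ m := by
      have := Finset.mem_range.1 hj
      omega
    have hpow : σ ^ m = σ ^ (m - 2 * j) * σ ^ (2 * j) := by
      rw [← pow_add, Nat.sub_add_cancel hj2]
    rw [Nat.choose_symm hj2, hpow, div_pow]
    have : σ ^ (m - 2 * j) ≠ 0 := pow_ne_zero _ hσ.ne'
    field_simp
  · intro _ m hm σ₀ T
    obtain ⟨M, hM⟩ := isCompact_Icc.exists_bound_of_continuousOn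
      (hc.mono (Icc_subset_Ici_self : Icc 0 T ⊆ Ici 0))
    set b : ℕ → ℝ := fun k => m.choose k * ratRoot (B / c 0) m ^ (m - k)
    set α : ℝ := m * ratRoot (B / c 0) m ^ (m - 1) with hα
    set N : ℕ → ℝ := powerIntegralBound M T
    -- One constant serves both estimates: the mean square needs only the first summand, the
    -- variance needs both. It involves neither `A`, `σ` nor `t`.
    refine ⟨remainderBound m b N σ₀ + 2 * crossBound m α b N σ₀, ?_⟩
    intro n σ A hσ hσ₀ Ω mΩ P 𝓕 W R p hW h c₁ hc₁ t htT
    have := hW.isProbabilityMeasure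
    obtain ⟨X, hB, hX, hXm, hXW, hR⟩ := h.exists_continuous_version hm hc hc0 hW
    have ht := t.coe_nonneg
    have hZ := memLp_powerIntegral hB hc hX hXm ht
    have hZN := integral_powerIntegral_sq_le hB hc hX hXm ht htT hM
    have hZ1 := integral_powerIntegral_odd hB hc hX hXm ht odd_one
    have hZ12 : ∫ ω, powerIntegral c X t 1 ω * powerIntegral c X t 2 ω ∂P = 0 := by
      rw [integral_powerIntegral_mul hB hc hX hXm ht 1 2 (E := fun _ _ => 0)
        fun s u => hB.integral_pow_mul_pow_of_odd s u (by decide)]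
      simp
    have hZ11 := integral_powerIntegral_mul hB hc hX hXm ht 1 1 (E := fun s u => min s u)
      fun s u => by simpa using hB.integral_mul_self s u
    set κ : ℝ := A + c₁ ^ m * ∫ u in (0 : ℝ)..t, c u with hκ
    have hTX : taylorProcess m c A c₁ σ W t =ᵐ[P]
        fun ω => κ + α * σ * powerIntegral c X t 1 ω := by
      filter_upwards [hXW] with ω h1
      rw [hα, ← hc₁, ← taylorProcess_eq hc hX ht]
      simp only [taylorProcess, h1]
    have hRX : R t =ᵐ[P] fun ω => κ + α * σ * powerIntegral c X t 1 ω
        + ∑ k ∈ Finset.Icc 2 m, b k * σ ^ k * powerIntegral c X t k ω := by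
      filter_upwards [hR t] with ω h1
      rw [h1, sum_range_eq_add_sum_Icc _ hm, hκ, hα, hc₁]
      simp only [powerIntegral, pow_zero, pow_one, Nat.choose_zero_right, Nat.choose_one_right,
        mul_one, Nat.cast_one, one_mul, Nat.sub_zero]
      ring
    have hTm : MemLp (fun ω => κ + α * σ * powerIntegral c X t 1 ω) 2 P :=
      (memLp_const κ).add ((hZ 1).const_mul _)
    have hDm : MemLp (fun ω => ∑ k ∈ Finset.Icc 2 m, b k * σ ^ k * powerIntegral c X t k ω) 2 P :=
      memLp_finsetSum _ fun k _ => (hZ k).const_mul _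
    have hV : Var[fun ω => κ + α * σ * powerIntegral c X t 1 ω; P]
        = (m : ℝ) ^ 2 * σ ^ 2 * c₁ ^ (2 * m - 2) *
          ∫ u in (0 : ℝ)..t, ∫ s in (0 : ℝ)..t, c u * c s * min u s := by
      rw [variance_affine (hZ 1), hZ1, hZ11, hα, ← hc₁, show 2 * m - 2 = (m - 1) * 2 by omega,
        pow_mul]
      ring
    -- Nonnegativity comes for free, since the quantity bounds an absolute value; it lets the larger
    -- constant serve for the mean square.
    have hcross : 0 ≤ crossBound m α b N σ₀ * σ ^ 4 :=
      (abs_nonneg _).trans (abs_covariance_remainder_le (b := b) hZ hZN hZ1 hZ12 hσ hσ₀ m κ α)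
    refine ⟨(hTm.add hDm).ae_eq hRX.symm, hTm.ae_eq hTX.symm, ?_, ?_, ?_, ?_⟩
    · have e : ∫ ω, (R t ω - taylorProcess m c A c₁ σ W t ω) ^ 2 ∂P
          = ∫ ω, (∑ k ∈ Finset.Icc 2 m, b k * σ ^ k * powerIntegral c X t k ω) ^ 2 ∂P := by
        refine integral_congr_ae ?_
        filter_upwards [hRX, hTX] with ω h1 h2
        rw [h1, h2, add_sub_cancel_left]
      rw [e]
      refine (integral_remainder_sq_le hZ hZN hσ hσ₀ m).trans ?_
      linarith
    · have e : ∫ ω, taylorProcess m c A c₁ σ W t ω ^ 2 ∂P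
          = ∫ ω, (κ + α * σ * powerIntegral c X t 1 ω) ^ 2 ∂P := by
        refine integral_congr_ae ?_
        filter_upwards [hTX] with ω h2
        rw [h2]
      rw [e, integral_sq_affine (hZ 1) hZ1, hZ11, hα, ← hc₁, hκ,
        show 2 * m - 2 = (m - 1) * 2 by omega]
      ring
    · rw [variance_congr hTX, hV]
    · rw [← hV, variance_congr hRX]
      exact abs_variance_sub_le hZ hZN hZ1 hZ12 hσ hσ₀ m κ α
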